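/- **Theorem.** Let $\phi,\psi$ be the Meyer scaling function and mother wavelet built from a smooth auxiliary function $\nu$ (that is, $\nu\in C^\infty(\mathbb R)$, $\nu=0$ on $(-\infty,0]$, $\nu=1$ on $[1,\infty)$, $\nu(x)+\nu(1-x)=1$): with $F[h](t)=\int h(x)e^{-itx}\,dx$, $F[\phi](\xi)=\cos\big(\tfrac\pi2\nu(\tfrac{3|\xi|}{2\pi}-1)\big)$ for $|\xi|\le\tfrac{4\pi}3$ and $0$ otherwise, and $F[\psi](\xi)=e^{-i\xi/2}b(|\xi|)$, where $b(u)=\sin\big(\tfrac\pi2\nu(\tfrac{3u}{2\pi}-1)\big)$ for $u\le\tfrac{4\pi}3$, $b(u)=\cos\big(\tfrac\pi2\nu(\tfrac{3u}{4\pi}-1)\big)$ for $\tfrac{4\pi}3<u\le\tfrac{8\pi}3$ and $b(u)=0$ for $u>\tfrac{8\pi}3$. Write $h_{lk}(x)=2^{l/2}h(2^lx-k)$. For $s,L>0$ let $B(s,L)$ be the set of (continuous, bounded) probability densities $f:\mathbb R\to[0,\infty)$ with $$\|f\|_{s,\infty,\infty}=\sup_{k\in\mathbb Z}|\langle f,\phi_{0k}\rangle|+\sup_{l\ge0}2^{l(s+1/2)}\sup_{k\in\mathbb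 Z}|\langle f,\psi_{lk}\rangle|\le L.$$ Let $\varphi$ be a probability measure on $\mathbb R$ and let $Y_1,\dots,Y_n$ be i.i.d. with law $f*\varphi$, that is, copies of $Y=X+\epsilon$ with $X$ of density $f$ and $\epsilon$ of law $\varphi$ independent. Let $$R_n(B(s,L))=\inf_{\tilde f_n}\sup_{f\in B(s,L)}E\sup_{x\in\mathbb R}|\tilde f_n(x)-f(x)|,$$ where the infimum is over all estimators, that is, measurable functions of $(Y_1,\dots,Y_n)$ with values in the bounded functions on $\mathbb R$. Let $C,C'>0$, $\alpha>0$, $w,w'\in\mathbb R$ and $t_1,c_0\ge0$ and suppose that $F[\varphi](t)=\int e^{-itx}\,d\varphi(x)$ is differentiable at every $t$ with $|t|>t_1$, and satisfies for these $t$ $$|F[\varphi](t)|\le C(1+t^2)^{-w/2}e^{-c_0|t|^\alpha},\qquad |(F[\varphi])'(t)|\le C'(1+t^2)^{-w'/2}e^{-c_0|t|^\alpha}.$$ Then there is a constant $c>0$ such that for every $n\ge2$ $$R_n(B(s,L))\ge c\left(\frac1{\log n}\right)^{s/\alpha}\quad\text{if }c_0>0,$$ $$R_n(B(s,L))\ge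 c\left(\frac{\log n}{n}\right)^{s/(2s+2w+1)}\quad\text{if }c_0=0\text{ and }w'\ge w\ge0.$$ The constant $c$ depends only on $\nu$ (the choice of the Meyer basis), $s,L,C,C',\alpha,w,w',c_0,t_1$ and on a number $M$ with $\varphi([-M,M])\ge\tfrac12$; it depends on $\varphi$ only through these quantities. -/

import Mathlib

open MeasureTheory
open scoped ENNReal ContDiff

noncomputable section

/-- Auxiliary functions of Meyer's construction: smooth, `0` on `(-∞, 0]`, `1` on `[1, ∞)`, and
`ν x + ν (1 - x) = 1`. Every smooth Meyer wavelet basis comes from such a function. -/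
structure IsMeyerAux (ν : ℝ → ℝ) : Prop where
  contDiff : ContDiff ℝ ∞ ν
  eq_zero : ∀ x ≤ 0, ν x = 0
  eq_one : ∀ x, 1 ≤ x → ν x = 1
  symm : ∀ x, ν x + ν (1 - x) = 1

/-- Fourier transform of the Meyer scaling function. -/
def meyerScalingHat (ν : ℝ → ℝ) (ξ : ℝ) : ℂ :=
  if |ξ| ≤ 4 * Real.pi / 3 then
    ((Real.cos (Real.pi / 2 * ν (3 * |ξ| / (2 * Real.pi) - 1)) : ℝ) : ℂ)
  else 0

/-- Fourier transform of the Meyer mother wavelet. -/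
def meyerWaveletHat (ν : ℝ → ℝ) (ξ : ℝ) : ℂ :=
  Complex.exp (-(Complex.I * ξ / 2)) *
    (if |ξ| ≤ 4 * Real.pi / 3 then
      ((Real.sin (Real.pi / 2 * ν (3 * |ξ| / (2 * Real.pi) - 1)) : ℝ) : ℂ)
    else if |ξ| ≤ 8 * Real.pi / 3 then
      ((Real.cos (Real.pi / 2 * ν (3 * |ξ| / (4 * Real.pi) - 1)) : ℝ) : ℂ)
    else 0)

/-- Inverse Fourier transform `x ↦ (2π)⁻¹ ∫ h(ξ) e^{iξx} dξ`. It is applied only to `h` with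
`h (-ξ) = conj (h ξ)`, where the integral is real. -/
def realInvFourier (h : ℝ → ℂ) (x : ℝ) : ℝ :=
  ((1 / (2 * Real.pi) : ℂ) * ∫ ξ : ℝ, h ξ * Complex.exp (Complex.I * ξ * x)).re

/-- The Meyer scaling function `ϕ`. -/
def meyerScaling (ν : ℝ → ℝ) : ℝ → ℝ := realInvFourier (meyerScalingHat ν)

/-- The Meyer mother wavelet `ψ`. -/
def meyerWavelet (ν : ℝ → ℝ) : ℝ → ℝ := realInvFourier (meyerWaveletHat ν)

/-- `h_{lk}(x) = 2^{l/2} h(2^l x - k)`. -/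
def dilTrans (h : ℝ → ℝ) (l : ℕ) (k : ℤ) (x : ℝ) : ℝ :=
  (2 : ℝ) ^ ((l : ℝ) / 2) * h ((2 : ℝ) ^ l * x - k)

/-- The scaling coefficients `α_{0k}(f) = ⟨f, ϕ_{0k}⟩`. -/
def scalingCoeff (ν f : ℝ → ℝ) (k : ℤ) : ℝ :=
  ∫ x, f x * dilTrans (meyerScaling ν) 0 k x

/-- The wavelet coefficients `β_{lk}(f) = ⟨f, ψ_{lk}⟩`. -/
def waveletCoeff (ν f : ℝ → ℝ) (l : ℕ) (k : ℤ) : ℝ :=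
  ∫ x, f x * dilTrans (meyerWavelet ν) l k x

/-- The Besov norm `‖f‖_{s,∞,∞}`, with values in `[0, ∞]`. -/
def besovNorm (ν : ℝ → ℝ) (s : ℝ) (f : ℝ → ℝ) : ℝ≥0∞ :=
  (⨆ k : ℤ, ENNReal.ofReal |scalingCoeff ν f k|) +
    ⨆ l : ℕ, ENNReal.ofReal ((2 : ℝ) ^ ((l : ℝ) * (s + 1 / 2))) *
      ⨆ k : ℤ, ENNReal.ofReal |waveletCoeff ν f l k|

/-- The class `B(s, L)` of probability densities in the Hölder-Besov ball of radius `L`. For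
`s > 0` the elements of `B^s_{∞∞}` have a unique continuous version, and it is this version
whose values at points are compared with those of an estimator. -/
def densityBall (ν : ℝ → ℝ) (s L : ℝ) : Set (ℝ → ℝ) :=
  {f | Continuous f ∧ MemLp f ∞ volume ∧ besovNorm ν s f ≤ ENNReal.ofReal L ∧
    (∀ x, 0 ≤ f x) ∧ Integrable f volume ∧ ∫ x, f x = 1}

/-- The law of `Y = X + ε`, with `X` of density `f` and `ε` of law `φ` independent. -/
def obsLaw (f : ℝ → ℝ) (φ : Measure ℝ) : Measure ℝ :=
  (volume.withDensity fun x => ENNReal.ofReal (f x)).conv φ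

/-- Estimators: measurable functions of the sample `(Y₁, …, Yₙ)` with values in the space of
bounded functions on `ℝ`. Only measurability of each point evaluation is required. -/
def IsEstimator (n : ℕ) (T : (Fin n → ℝ) → ℝ → ℝ) : Prop :=
  (∀ x, Measurable fun y => T y x) ∧ ∀ y, ∃ B : ℝ, ∀ x, |T y x| ≤ B

/-- The sup-norm distance, with values in `[0, ∞]`. -/
def supDist (g f : ℝ → ℝ) : ℝ≥0∞ := ⨆ x : ℝ, ENNReal.ofReal |g x - f x|

/-- The minimax sup-norm risk `R_n(B(s, L))` for the error law `φ`. -/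
def minimaxRisk (ν : ℝ → ℝ) (φ : Measure ℝ) (n : ℕ) (s L : ℝ) : ℝ≥0∞ :=
  ⨅ T : {T : (Fin n → ℝ) → ℝ → ℝ // IsEstimator n T}, ⨆ f ∈ densityBall ν s L,
    ∫⁻ y, supDist (T.1 y) f ∂(Measure.pi fun _ : Fin n => obsLaw f φ)

/-- `F[φ](t) = ∫ e^{-itx} dφ(x)`. -/
def fourierLaw (φ : Measure ℝ) (t : ℝ) : ℂ := ∫ x, Complex.exp (-(Complex.I * t * x)) ∂φ

/-- The assumption on the decay of `F[φ]` and of its derivative. -/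
def FourierDecay (φ : Measure ℝ) (C C' α w w' c₀ t₁ : ℝ) : Prop :=
  ∀ t : ℝ, t₁ < |t| →
    DifferentiableAt ℝ (fourierLaw φ) t ∧
    ‖fourierLaw φ t‖ ≤ C * (1 + t ^ 2) ^ (-w / 2) * Real.exp (-c₀ * |t| ^ α) ∧
    ‖deriv (fourierLaw φ) t‖ ≤ C' * (1 + t ^ 2) ^ (-w' / 2) * Real.exp (-c₀ * |t| ^ α)

end

noncomputable section

namespace Deconvolution

open Filter Topology FourierTransform

/-! The proof tests many hypotheses. A fixed density `f₀` (`baseDensity`) is perturbed to `f₀ +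
g_m`, where `g_m(x) = A G(r(x - a_m))` (`bump`), `A = γ r^(-s)`, and the centres `a_m = 3m/r`, `m <
N`, lie in `[0, 1]`. The profile `G` has spectrum in `2 ≤ |t| ≤ 4`, so `g_m` lives at frequencies of
order `r` and its Besov norm is at most a constant times `γ`; two alternatives differ by at least
`A/2` at a centre. If `n` observations cannot tell the `N` alternatives apart, the risk is at least
`A/8`.

The data only see `g_m * φ`. Under the law of an observation from `f₀`, the likelihood ratio has
second moment `1 + ∫ (g_m * φ)² / (f₀ * φ)`. Since `f₀` has tails of order `x⁻²` and `φ` charges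
`[-M, M]`, the denominator is at least `κ/(1 + x²)`, and what remains is `∫ (1 + x²)(g_m * φ)²`. By
Plancherel the weight `1` costs the size of the product of the two Fourier transforms, and the
weight `x²` its Lipschitz constant; this is where the decay of `(F[φ])'` enters. If `F[φ]` and its
derivative are at most `S` on `2r ≤ |t| ≤ 4r`, the alternatives are indistinguishable as soon as `(1
+ K A² S²/r)^n ≤ N/4` (`exists_le_minimaxRisk`).

When `c₀ > 0`, taking `r` of order `(log n)^(1/α)` makes `n S²` bounded, and `N = 16` suffices. When
`c₀ = 0`, `S` is of order `r^(-w)`; with `r` of order `(n / log n)^(1/(2s+2w+1))` the left side is a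
small power of `n`, dominated by `N` of order `r`. The growing number of alternatives is what
produces the logarithm. -/

/-! ### Reduction of estimation to testing many hypotheses. -/

theorem lintegral_pi_prod {α : Type*} [MeasurableSpace α] (μ : Measure α) [IsProbabilityMeasure μ]
    {n : ℕ} (f : Fin n → α → ℝ≥0∞) (hf : ∀ i, Measurable (f i)) :
    ∫⁻ y, ∏ i, f i (y i) ∂(Measure.pi fun _ : Fin n => μ) = ∏ i, ∫⁻ x, f i x ∂μ := by
  have hind := ProbabilityTheory.iIndepFun_pi (μ := fun _ : Fin n => μ) (X := f)
    fun i => (hf i).aemeasurable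
  rw [ProbabilityTheory.lintegral_prod_eq_prod_lintegral_of_indepFun Finset.univ _ hind
    fun i => (hf i).comp (measurable_pi_apply i)]
  refine Finset.prod_congr rfl fun i _ => ?_
  exact (measurePreserving_eval (fun _ : Fin n => μ) i).lintegral_comp (hf i)

theorem pi_withDensity {α : Type*} [MeasurableSpace α] (μ : Measure α) [IsProbabilityMeasure μ]
    (n : ℕ) (f : α → ℝ≥0∞) (hf : Measurable f) [IsProbabilityMeasure (μ.withDensity f)] :
    (Measure.pi fun _ : Fin n => μ.withDensity f) =
      (Measure.pi fun _ : Fin n => μ).withDensity fun y => ∏ i, f (y i) := by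
  refine Measure.pi_eq fun t ht => ?_
  rw [withDensity_apply _ (MeasurableSet.univ_pi ht),
    ← lintegral_indicator (MeasurableSet.univ_pi ht)]
  have h : ∀ y : Fin n → α, (Set.univ.pi t).indicator (fun y => ∏ i, f (y i)) y =
      ∏ i, (t i).indicator f (y i) := by
    intro y
    by_cases hy : y ∈ Set.univ.pi t
    · rw [Set.indicator_of_mem hy]
      exact Finset.prod_congr rfl fun i _ => (Set.indicator_of_mem (hy i trivial) f).symm
    · rw [Set.indicator_of_notMem hy]
      simp only [Set.mem_univ_pi, not_forall] at hy
      obtain ⟨i, hi⟩ := hy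
      exact (Finset.prod_eq_zero (Finset.mem_univ i) (Set.indicator_of_notMem hi f)).symm
  simp_rw [h]
  rw [lintegral_pi_prod μ (fun i => (t i).indicator f) fun i => hf.indicator (ht i)]
  exact Finset.prod_congr rfl fun i _ => by
    rw [lintegral_indicator (ht i), withDensity_apply _ (ht i)]

/-- This is `(x - N/2)² ≥ 0`. Applied to a likelihood ratio on disjoint acceptance sets, the
constant term sums to at most `N/4` in total, and the quadratic term is controlled by the second
moment. -/
theorem le_quarter_add_sq_div (N : ℝ) (hN : 0 < N) (x : ℝ≥0∞) :
    x ≤ ENNReal.ofReal (N / 4) + ENNReal.ofReal (1 / N) * x ^ 2 := by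
  induction x using ENNReal.recTopCoe with
  | top =>
    have : ENNReal.ofReal (1 / N) ≠ 0 := by
      rw [Ne, ENNReal.ofReal_eq_zero, not_le]; positivity
    rw [ENNReal.top_pow two_ne_zero, ENNReal.mul_top this, add_top]
  | coe x =>
    rw [← ENNReal.ofReal_coe_nnreal, ← ENNReal.ofReal_pow x.coe_nonneg,
      ← ENNReal.ofReal_mul (by positivity),
      ← ENNReal.ofReal_add (by positivity) (by positivity)]
    refine ENNReal.ofReal_le_ofReal ?_
    have h : N / 4 + 1 / N * (x : ℝ) ^ 2 - x = (x - N / 2) ^ 2 / N := by field_simp; ring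
    have : 0 ≤ ((x : ℝ) - N / 2) ^ 2 / N := by positivity
    linarith

/-- If `N` alternatives have second moment of the likelihood ratio at most `N / 4`, no test can
identify them with average probability above `1 / 2`. -/
theorem sum_withDensity_le {Ω : Type*} [MeasurableSpace Ω] (Q : Measure Ω) [IsProbabilityMeasure Q]
    {N : ℕ} (hN : 0 < N) (ℓ : Fin N → Ω → ℝ≥0∞)
    (A : Fin N → Set Ω) (hA : ∀ m, MeasurableSet (A m))
    (hdisj : Pairwise (Function.onFun Disjoint A))
    (hE : ∀ m, ∫⁻ y, ℓ m y ^ 2 ∂Q ≤ ENNReal.ofReal ((N : ℝ) / 4)) :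
    ∑ m, Q.withDensity (ℓ m) (A m) ≤ ENNReal.ofReal ((N : ℝ) / 2) := by
  have hN' : (0 : ℝ) < N := by exact_mod_cast hN
  have h1 : ∀ m, Q.withDensity (ℓ m) (A m) ≤
      ENNReal.ofReal ((N : ℝ) / 4) * Q (A m) + ENNReal.ofReal (1 / 4) := by
    intro m
    rw [withDensity_apply _ (hA m)]
    calc ∫⁻ y in A m, ℓ m y ∂Q
        ≤ ∫⁻ y in A m, (ENNReal.ofReal ((N : ℝ) / 4) + ENNReal.ofReal (1 / N) * ℓ m y ^ 2) ∂Q :=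
          lintegral_mono fun y => le_quarter_add_sq_div N hN' _
      _ = ENNReal.ofReal ((N : ℝ) / 4) * Q (A m) +
          ENNReal.ofReal (1 / N) * ∫⁻ y in A m, ℓ m y ^ 2 ∂Q := by
          rw [lintegral_add_left measurable_const, lintegral_const_mul' _ _ (by simp)]
          simp
      _ ≤ ENNReal.ofReal ((N : ℝ) / 4) * Q (A m) +
          ENNReal.ofReal (1 / N) * ENNReal.ofReal ((N : ℝ) / 4) := by
          gcongr
          exact (setLIntegral_le_lintegral _ _).trans (hE m)
      _ = _ := by
          rw [← ENNReal.ofReal_mul (by positivity)]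
          congr 2
          field_simp
  calc ∑ m, Q.withDensity (ℓ m) (A m)
      ≤ ∑ m, (ENNReal.ofReal ((N : ℝ) / 4) * Q (A m) + ENNReal.ofReal (1 / 4)) :=
        Finset.sum_le_sum fun m _ => h1 m
    _ = ENNReal.ofReal ((N : ℝ) / 4) * Q (⋃ m, A m) + N * ENNReal.ofReal (1 / 4) := by
        rw [Finset.sum_add_distrib, ← Finset.mul_sum, measure_iUnion hdisj hA, tsum_fintype]
        simp
    _ ≤ ENNReal.ofReal ((N : ℝ) / 4) * 1 + N * ENNReal.ofReal (1 / 4) := by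
        gcongr
        exact prob_le_one
    _ = _ := by
        rw [← ENNReal.ofReal_natCast, ← ENNReal.ofReal_mul (by positivity), mul_one,
          ← ENNReal.ofReal_add (by positivity) (by positivity)]
        congr 1
        ring

/-- An estimator yields a test: accept `m` when it is within `δ` of `f m` at all the points `x j`.
Using finitely many points keeps these events measurable, and separation at the single point `x m`
makes them disjoint. The test fails with average probability at least `1/2`, at a loss of at least
`δ`. -/
theorem ofReal_le_minimaxRisk (ν : ℝ → ℝ) (φ : Measure ℝ) (n : ℕ) (s L : ℝ) {N : ℕ} (hN : 0 < N)
    (f : Fin N → ℝ → ℝ) (hf : ∀ m, f m ∈ densityBall ν s L) (x : Fin N → ℝ) {δ : ℝ} (hδ : 0 < δ)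
    (hsep : ∀ m m', m ≠ m' → 2 * δ ≤ |f m (x m) - f m' (x m)|)
    (Q : Measure ℝ) [IsProbabilityMeasure Q] (ℓ : Fin N → ℝ → ℝ≥0∞) (hℓ : ∀ m, Measurable (ℓ m))
    (hobs : ∀ m, obsLaw (f m) φ = Q.withDensity (ℓ m))
    (hprob : ∀ m, IsProbabilityMeasure (obsLaw (f m) φ))
    (hE : ∀ m, (∫⁻ y, ℓ m y ^ 2 ∂Q) ^ n ≤ ENNReal.ofReal ((N : ℝ) / 4)) :
    ENNReal.ofReal (δ / 2) ≤ minimaxRisk ν φ n s L := by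
  have hN' : (0 : ℝ) < N := by exact_mod_cast hN
  refine le_iInf fun T => ?_
  obtain ⟨T, hT, -⟩ := T
  set P : Fin N → Measure (Fin n → ℝ) := fun m => Measure.pi fun _ => obsLaw (f m) φ with hP
  have hPprob : ∀ m, IsProbabilityMeasure (P m) := fun m => by
    have := hprob m
    simp only [hP]; infer_instance
  set A : Fin N → Set (Fin n → ℝ) := fun m => {y | ∀ j, |T y (x j) - f m (x j)| < δ} with hAdef
  have hA : ∀ m, MeasurableSet (A m) := fun m => by
    simp only [hAdef, Set.ofPred_forall]
    refine MeasurableSet.iInter fun j => ?_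
    exact measurableSet_lt (((hT (x j)).sub measurable_const).abs) measurable_const
  have hdisj : Pairwise (Function.onFun Disjoint A) := by
    intro m m' hmm
    rw [Function.onFun, Set.disjoint_left]
    intro y hy hy'
    have h1 := hy m
    have h2 := hy' m
    have h3 := hsep m m' hmm
    have h4 : |f m (x m) - f m' (x m)| ≤
        |T y (x m) - f m (x m)| + |T y (x m) - f m' (x m)| := by
      rw [show f m (x m) - f m' (x m) =
        (T y (x m) - f m' (x m)) - (T y (x m) - f m (x m)) by ring]
      exact (abs_sub _ _).trans_eq (add_comm _ _)
    linarith
  have hPd : ∀ m, P m = (Measure.pi fun _ : Fin n => Q).withDensity fun y => ∏ i, ℓ m (y i) := by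
    intro m
    have hp := hprob m
    simp only [hP, hobs m] at hp ⊢
    exact pi_withDensity Q n (ℓ m) (hℓ m)
  have hsum : ∑ m, P m (A m) ≤ ENNReal.ofReal ((N : ℝ) / 2) := by
    simp_rw [hPd]
    refine sum_withDensity_le _ hN _ A hA hdisj fun m => ?_
    refine le_trans (le_of_eq ?_) (hE m)
    simp_rw [← Finset.prod_pow]
    rw [lintegral_pi_prod Q (fun _ z => ℓ m z ^ 2) fun _ => (hℓ m).pow_const 2]
    simp
  have hrisk : ∀ m, ENNReal.ofReal δ * (P m) (A m)ᶜ ≤ ∫⁻ y, supDist (T y) (f m) ∂(P m) := by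
    intro m
    rw [← setLIntegral_const, ← lintegral_indicator (hA m).compl]
    refine lintegral_mono fun y => ?_
    by_cases hy : y ∈ (A m)ᶜ
    · rw [Set.indicator_of_mem hy]
      simp only [hAdef, Set.mem_compl_iff, Set.mem_ofPred_eq, not_forall, not_lt] at hy
      obtain ⟨j, hj⟩ := hy
      exact (ENNReal.ofReal_le_ofReal hj).trans
        (le_iSup (fun z => ENNReal.ofReal |T y z - f m z|) (x j))
    · rw [Set.indicator_of_notMem hy]
      exact zero_le
  set R := ⨆ f ∈ densityBall ν s L, ∫⁻ y, supDist (T y) f ∂(Measure.pi fun _ : Fin n => obsLaw f φ)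
  have hR : ∀ m, ∫⁻ y, supDist (T y) (f m) ∂(P m) ≤ R := fun m =>
    le_iSup₂ (f := fun f (_ : f ∈ densityBall ν s L) =>
      ∫⁻ y, supDist (T y) f ∂(Measure.pi fun _ : Fin n => obsLaw f φ)) (f m) (hf m)
  have hcompl : ENNReal.ofReal ((N : ℝ) / 2) ≤ ∑ m, P m (A m)ᶜ := by
    have h1 : ∑ m, P m (A m) + ∑ m, P m (A m)ᶜ = ENNReal.ofReal ((N : ℝ) / 2) +
        ENNReal.ofReal ((N : ℝ) / 2) := by
      rw [← Finset.sum_add_distrib, ← ENNReal.ofReal_add (by positivity) (by positivity)]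
      simp_rw [fun m => measure_add_measure_compl (μ := P m) (hA m)]
      simp
    by_contra! h
    have h2 := ENNReal.add_lt_add_of_le_of_lt
      (ne_top_of_le_ne_top ENNReal.ofReal_ne_top hsum) hsum h
    exact absurd h1 h2.ne
  have hfin : ENNReal.ofReal δ * ENNReal.ofReal ((N : ℝ) / 2) ≤ N * R := by
    calc ENNReal.ofReal δ * ENNReal.ofReal ((N : ℝ) / 2)
        ≤ ENNReal.ofReal δ * ∑ m, P m (A m)ᶜ := by gcongr
      _ = ∑ m, ENNReal.ofReal δ * P m (A m)ᶜ := Finset.mul_sum _ _ _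
      _ ≤ ∑ _m : Fin N, R := Finset.sum_le_sum fun m _ => (hrisk m).trans (hR m)
      _ = N * R := by simp
  have hN0 : (N : ℝ≥0∞) ≠ 0 := by exact_mod_cast hN.ne'
  rw [← ENNReal.mul_le_mul_iff_right hN0 (ENNReal.natCast_ne_top N)]
  refine le_trans (le_of_eq ?_) hfin
  rw [← ENNReal.ofReal_natCast, ← ENNReal.ofReal_mul (by positivity),
    ← ENNReal.ofReal_mul (by positivity)]
  congr 1
  ring

/-! ### Plancherel and weighted `L²` bounds from the Fourier side. -/

/-- The Fourier transform `t ↦ ∫ u(x) e^{-itx} dx`. -/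
def ft (u : ℝ → ℂ) (t : ℝ) : ℂ := ∫ x, u x * Complex.exp (-(Complex.I * t * x))

theorem norm_exp_neg_I_mul (t x : ℝ) : ‖Complex.exp (-(Complex.I * t * x))‖ = 1 := by
  rw [show -(Complex.I * (t : ℂ) * x) = ((-(t * x) : ℝ) : ℂ) * Complex.I by push_cast; ring]
  exact Complex.norm_exp_ofReal_mul_I _

theorem fourier_eq_ft (u : ℝ → ℂ) (w : ℝ) : 𝓕 u w = ft u (2 * Real.pi * w) := by
  rw [Real.fourier_real_eq_integral_exp_smul, ft]
  refine integral_congr_ae (.of_forall fun x => ?_)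
  simp only [smul_eq_mul]
  rw [mul_comm]
  congr 2
  push_cast
  ring

theorem integrable_mul_exp {u : ℝ → ℂ} (hu : Integrable u) (t : ℝ) :
    Integrable fun x : ℝ => u x * Complex.exp (-(Complex.I * t * x)) := by
  refine hu.mul_bdd (c := 1) (by fun_prop) (.of_forall fun x => (norm_exp_neg_I_mul t x).le)

theorem norm_ft_le {u : ℝ → ℂ} (t : ℝ) : ‖ft u t‖ ≤ ∫ x, ‖u x‖ := by
  refine (norm_integral_le_integral_norm _).trans_eq ?_
  simp_rw [norm_mul, norm_exp_neg_I_mul, mul_one]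

theorem continuous_ft {u : ℝ → ℂ} (hu : Integrable u) : Continuous (ft u) := by
  refine continuous_of_dominated (fun t => (integrable_mul_exp hu t).aestronglyMeasurable)
    (bound := fun x => ‖u x‖) (fun t => .of_forall fun x => ?_) hu.norm
    (.of_forall fun x => by fun_prop)
  rw [norm_mul, norm_exp_neg_I_mul, mul_one]

/-- The adjoint of the Fourier transform is its inverse, so `∫ ⟨𝓕u, 𝓕u⟩ = ∫ ⟨u, 𝓕⁻¹𝓕u⟩`; rescaling
the frequency by `2π` gives the factor. -/
theorem integral_norm_sq_eq {u : ℝ → ℂ} (hc : Continuous u) (hu : Integrable u)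
    (hft : Integrable (ft u)) :
    ∫ x, ‖u x‖ ^ 2 = (1 / (2 * Real.pi)) * ∫ t, ‖ft u t‖ ^ 2 := by
  have hF : Integrable (𝓕 u) := by
    have := hft.comp_mul_left' (R := 2 * Real.pi) (by positivity)
    exact this.congr (.of_forall fun w => (fourier_eq_ft u w).symm)
  have h := VectorFourier.integral_sesq_fourierIntegral_eq_neg_flip (μ := volume) (ν := volume)
    (L := innerₗ ℝ) (e := Real.fourierChar) (innerSL ℂ) Real.continuous_fourierChar
    continuous_inner hu hF
  have h1 : ∀ x, VectorFourier.fourierIntegral Real.fourierChar volume (-(innerₗ ℝ).flip) (𝓕 u) x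
      = u x := by
    intro x
    have := congrFun (hc.fourierInv_fourier_eq hu hF) x
    rw [Real.fourierInv_eq] at this
    rw [← this, VectorFourier.fourierIntegral]
    refine integral_congr_ae (.of_forall fun v => ?_)
    simp
  have h2 : ∀ x, VectorFourier.fourierIntegral Real.fourierChar volume (innerₗ ℝ) u x = 𝓕 u x := by
    intro x; rfl
  simp_rw [h1, h2] at h
  have h3 : ∫ w, ‖𝓕 u w‖ ^ 2 = ∫ x, ‖u x‖ ^ 2 := by
    have h4 : ∀ z : ℂ, innerSL ℂ z z = ((‖z‖ ^ 2 : ℝ) : ℂ) := by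
      intro z
      simp [inner_self_eq_norm_sq_to_K]
    simp_rw [h4] at h
    exact Complex.ofReal_injective (integral_complex_ofReal.symm.trans
      (h.trans integral_complex_ofReal))
  rw [← h3]
  simp_rw [fourier_eq_ft]
  rw [Measure.integral_comp_mul_left (fun t => ‖ft u t‖ ^ 2) (2 * Real.pi)]
  rw [abs_of_pos (by positivity)]
  simp

theorem integrable_ft {u : ℝ → ℂ} (hu : Integrable u) {a b : ℝ}
    (hsupp : ∀ t, t ∉ Set.Icc a b → ft u t = 0) : Integrable (ft u) :=
  (continuous_ft hu).integrable_of_hasCompactSupport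
    (HasCompactSupport.intro isCompact_Icc hsupp)

theorem lintegral_norm_sq_le {u : ℝ → ℂ} (hc : Continuous u) (hu : Integrable u) {B : ℝ}
    (hB : ∀ x, ‖u x‖ ≤ B) {a b S : ℝ} (hab : a ≤ b)
    (hsupp : ∀ t, t ∉ Set.Icc a b → ft u t = 0) (hS : ∀ t, ‖ft u t‖ ≤ S) :
    ∫⁻ x, ENNReal.ofReal (‖u x‖ ^ 2) ≤ ENNReal.ofReal (S ^ 2 * (b - a) / (2 * Real.pi)) := by
  have hi : Integrable fun x => ‖u x‖ ^ 2 := by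
    simp_rw [pow_two]
    exact hu.norm.bdd_mul (c := B) hc.norm.aestronglyMeasurable
      (.of_forall fun x => by simpa using hB x)
  rw [← ofReal_integral_eq_lintegral_ofReal hi (.of_forall fun x => by positivity)]
  refine ENNReal.ofReal_le_ofReal ?_
  rw [integral_norm_sq_eq hc hu (integrable_ft hu hsupp)]
  have h1 : ∫ t, ‖ft u t‖ ^ 2 ≤ S ^ 2 * (b - a) := by
    have h2 : ∫ t, ‖ft u t‖ ^ 2 = ∫ t in Set.Icc a b, ‖ft u t‖ ^ 2 := by
      refine (setIntegral_eq_integral_of_forall_compl_eq_zero fun t ht => ?_).symm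
      simp [hsupp t ht]
    rw [h2]
    calc ∫ t in Set.Icc a b, ‖ft u t‖ ^ 2 ≤ ∫ t in Set.Icc a b, S ^ 2 := by
          refine setIntegral_mono ?_ ?_ fun t => ?_
          · exact (((continuous_ft hu).norm.pow 2).continuousOn).integrableOn_compact isCompact_Icc
          · exact continuousOn_const.integrableOn_compact isCompact_Icc
          · exact pow_le_pow_left₀ (norm_nonneg _) (hS t) 2
      _ = S ^ 2 * (b - a) := by
          rw [setIntegral_const, Measure.real, Real.volume_Icc, ENNReal.toReal_ofReal (by linarith),
            smul_eq_mul, mul_comm]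
  rw [one_div, div_eq_inv_mul _ (2 * Real.pi)]
  exact mul_le_mul_of_nonneg_left h1 (by positivity)

theorem tendsto_exp_sub_one_div (x : ℝ) :
    Tendsto (fun j : ℕ => (Complex.exp (-(Complex.I * ((1 / ((j : ℝ) + 1) : ℝ) : ℂ) * x)) - 1) /
      ((1 / ((j : ℝ) + 1) : ℝ) : ℂ)) atTop (𝓝 (-(Complex.I * x))) := by
  have h : HasDerivAt (fun a : ℝ => Complex.exp (-(Complex.I * (a : ℂ) * x))) (-(Complex.I * x)) 0 := by
    have h1 : HasDerivAt (fun a : ℝ => -(Complex.I * (a : ℂ) * x)) (-(Complex.I * x)) 0 := by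
      have := (((hasDerivAt_id (0 : ℝ)).ofReal_comp.const_mul Complex.I).mul_const (x : ℂ)).neg
      simp only [Complex.ofReal_one, mul_one] at this
      exact this
    simpa using h1.cexp
  have h2 := h.tendsto_slope_zero
  have h3 : Tendsto (fun j : ℕ => 1 / ((j : ℝ) + 1)) atTop (𝓝[≠] 0) := by
    refine tendsto_nhdsWithin_iff.2 ⟨tendsto_one_div_add_atTop_nhds_zero_nat, .of_forall fun j => ?_⟩
    simp only [Set.mem_compl_iff, Set.mem_singleton_iff]
    positivity
  refine (h2.comp h3).congr fun j => ?_
  simp only [Function.comp, zero_add, Complex.real_smul, Complex.ofReal_zero]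
  simp [div_eq_inv_mul]

/-- Since `x u(x)` need not be integrable and `ft u` is only Lipschitz, multiplication by `x` is
replaced by `(e^{-iax} - 1)/a`, which corresponds to a difference quotient of `ft u`. Plancherel
bounds each of these uniformly in `a`, and Fatou's lemma passes to `a → 0`. -/
theorem lintegral_sq_mul_norm_sq_le {u : ℝ → ℂ} (hc : Continuous u) (hu : Integrable u) {B : ℝ}
    (hB : ∀ x, ‖u x‖ ≤ B) {R S : ℝ} (hR : 0 ≤ R)
    (hsupp : ∀ t, t ∉ Set.Icc (-R) R → ft u t = 0)
    (hS : ∀ t t', ‖ft u t - ft u t'‖ ≤ S * |t - t'|) :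
    ∫⁻ x, ENNReal.ofReal (x ^ 2 * ‖u x‖ ^ 2) ≤
      ENNReal.ofReal (S ^ 2 * (2 * R + 1) / (2 * Real.pi)) := by
  set a : ℕ → ℝ := fun j => 1 / ((j : ℝ) + 1) with ha
  have ha0 : ∀ j, 0 < a j := fun j => by simp only [ha]; positivity
  have ha1 : ∀ j, a j ≤ 1 := fun j => by
    simp only [ha]
    rw [div_le_one (by positivity)]
    simp
  set v : ℕ → ℝ → ℂ := fun j x =>
    u x * ((Complex.exp (-(Complex.I * (a j : ℂ) * x)) - 1) / (a j : ℂ)) with hv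
  have hvc : ∀ j, Continuous (v j) := fun j => by simp only [hv]; fun_prop
  have hve : ∀ (j : ℕ) (x : ℝ), ‖(Complex.exp (-(Complex.I * (a j : ℂ) * x)) - 1) / (a j : ℂ)‖ ≤ 2 / a j := by
    intro j x
    rw [norm_div, Complex.norm_real, Real.norm_of_nonneg (ha0 j).le]
    gcongr
    refine (norm_sub_le _ _).trans_eq ?_
    rw [norm_exp_neg_I_mul, norm_one]
    norm_num
  have hvi : ∀ j, Integrable (v j) := fun j =>
    hu.mul_bdd (c := 2 / a j) (by fun_prop) (.of_forall fun x => hve j x)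
  have hB0 : 0 ≤ B := (norm_nonneg _).trans (hB 0)
  have hvB : ∀ j x, ‖v j x‖ ≤ B * (2 / a j) := fun j x => by
    simp only [hv]
    rw [norm_mul]
    exact mul_le_mul (hB x) (hve j x) (norm_nonneg _) hB0
  have hvft : ∀ j t, ft (v j) t = (ft u (t + a j) - ft u t) / (a j : ℂ) := by
    intro j t
    rw [ft, ft, ft, ← integral_sub (integrable_mul_exp hu _) (integrable_mul_exp hu _),
      ← integral_div]
    refine integral_congr_ae (.of_forall fun x => ?_)
    simp only [hv]
    rw [show -(Complex.I * ((t + a j : ℝ) : ℂ) * x) =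
      -(Complex.I * (a j : ℂ) * x) + -(Complex.I * t * x) by push_cast; ring, Complex.exp_add]
    ring
  have hbound : ∀ j, ∫⁻ x, ENNReal.ofReal (‖v j x‖ ^ 2) ≤
      ENNReal.ofReal (S ^ 2 * (2 * R + 1) / (2 * Real.pi)) := by
    intro j
    -- The shift by `0 < a j ≤ 1` enlarges the support only to the left, whence the length `2R + 1`.
    have h := lintegral_norm_sq_le (hvc j) (hvi j) (hvB j) (a := -R - 1) (b := R) (S := S)
      (by linarith) ?_ ?_
    · refine h.trans_eq ?_
      congr 3
      ring
    · intro t ht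
      rw [hvft, hsupp t, hsupp (t + a j), sub_zero, zero_div]
      · intro h'
        exact ht ⟨by linarith [h'.1, ha1 j], by linarith [h'.2, ha0 j]⟩
      · intro h'
        exact ht ⟨by linarith [h'.1], h'.2⟩
    · intro t
      rw [hvft, norm_div, Complex.norm_real, Real.norm_of_nonneg (ha0 j).le, div_le_iff₀ (ha0 j)]
      refine (hS _ _).trans_eq ?_
      rw [add_sub_cancel_left, abs_of_pos (ha0 j)]
  have hlim : ∀ x, Tendsto (fun j => ENNReal.ofReal (‖v j x‖ ^ 2)) atTop
      (𝓝 (ENNReal.ofReal (x ^ 2 * ‖u x‖ ^ 2))) := by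
    intro x
    refine ENNReal.tendsto_ofReal ?_
    have h := (((tendsto_exp_sub_one_div x).const_mul (u x)).norm).pow 2
    convert! h using 2
    rw [norm_mul, norm_neg, norm_mul, Complex.norm_I, one_mul, Complex.norm_real, mul_pow,
      Real.norm_eq_abs, sq_abs, mul_comm]
  calc ∫⁻ x, ENNReal.ofReal (x ^ 2 * ‖u x‖ ^ 2)
      = ∫⁻ x, liminf (fun j => ENNReal.ofReal (‖v j x‖ ^ 2)) atTop :=
        lintegral_congr fun x => (hlim x).liminf_eq.symm
    _ ≤ liminf (fun j => ∫⁻ x, ENNReal.ofReal (‖v j x‖ ^ 2)) atTop :=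
        lintegral_liminf_le fun j => by
          have := hvc j
          exact (ENNReal.continuous_ofReal.comp ((hvc j).norm.pow 2)).measurable
    _ ≤ _ := liminf_le_of_le (by isBoundedDefault) fun b hb => by
        obtain ⟨j, hj⟩ := hb.exists
        exact hj.trans (hbound j)

theorem lintegral_one_add_sq_mul_norm_sq_le {u : ℝ → ℂ} (hc : Continuous u) (hu : Integrable u)
    {B : ℝ} (hB : ∀ x, ‖u x‖ ≤ B) {R S : ℝ} (hR : 1 ≤ R)
    (hsupp : ∀ t, t ∉ Set.Icc (-R) R → ft u t = 0) (hS₀ : ∀ t, ‖ft u t‖ ≤ S)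
    (hS : ∀ t t', ‖ft u t - ft u t'‖ ≤ S * |t - t'|) :
    ∫⁻ x, ENNReal.ofReal ((1 + x ^ 2) * ‖u x‖ ^ 2) ≤ ENNReal.ofReal (S ^ 2 * R) := by
  have h1 := lintegral_norm_sq_le hc hu hB (a := -R) (b := R) (by linarith) hsupp hS₀
  have h2 := lintegral_sq_mul_norm_sq_le hc hu hB (by linarith) hsupp hS
  have h3 : ∀ x, ENNReal.ofReal ((1 + x ^ 2) * ‖u x‖ ^ 2) =
      ENNReal.ofReal (‖u x‖ ^ 2) + ENNReal.ofReal (x ^ 2 * ‖u x‖ ^ 2) := fun x => by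
    rw [← ENNReal.ofReal_add (by positivity) (by positivity)]
    congr 1
    ring
  simp_rw [h3]
  rw [lintegral_add_left (show Measurable fun x => ENNReal.ofReal (‖u x‖ ^ 2) from
    (ENNReal.continuous_ofReal.comp (hc.norm.pow 2)).measurable)]
  refine (add_le_add h1 h2).trans ?_
  rw [← ENNReal.ofReal_add
    (div_nonneg (mul_nonneg (sq_nonneg _) (by linarith)) (by positivity))
    (div_nonneg (mul_nonneg (sq_nonneg _) (by linarith)) (by positivity))]
  refine ENNReal.ofReal_le_ofReal ?_
  rw [← add_div, div_le_iff₀ (by positivity)]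
  nlinarith [Real.pi_gt_three, mul_nonneg (sq_nonneg S) (by linarith : (0 : ℝ) ≤ R - 1),
    mul_nonneg (sq_nonneg S) (by linarith : (0 : ℝ) ≤ R),
    mul_nonneg (mul_nonneg (sq_nonneg S) (by linarith : (0 : ℝ) ≤ R))
      (by linarith [Real.pi_gt_three] : (0 : ℝ) ≤ Real.pi - 3)]

/-! ### The Fejér kernel and its Fourier transform. -/

/-- The Fejér kernel, normalised to `fejer 0 = 1`. -/
def fejer (x : ℝ) : ℝ := Real.sinc (x / 2) ^ 2

/-- The triangle function. -/
def tri (t : ℝ) : ℝ := max 0 (1 - |t|)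

theorem continuous_fejer : Continuous fejer :=
  (Real.continuous_sinc.comp (continuous_id.div_const 2)).pow 2

theorem continuous_tri : Continuous tri := by unfold tri; fun_prop

theorem fejer_nonneg (x : ℝ) : 0 ≤ fejer x := sq_nonneg _

theorem fejer_zero : fejer 0 = 1 := by simp [fejer]

theorem fejer_le_one (x : ℝ) : fejer x ≤ 1 := by
  rw [fejer, sq_le_one_iff_abs_le_one]
  exact Real.abs_sinc_le_one _

theorem fejer_mul_sq (x : ℝ) : fejer x * x ^ 2 = 4 * Real.sin (x / 2) ^ 2 := by
  rcases eq_or_ne x 0 with rfl | hx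
  · simp
  · rw [fejer, Real.sinc_of_ne_zero (by simpa using hx)]
    field_simp
    ring

theorem fejer_mul_one_add_sq_le (x : ℝ) : fejer x * (1 + x ^ 2) ≤ 5 := by
  have h1 := fejer_le_one x
  have h2 := fejer_mul_sq x
  have h3 := Real.sin_sq_le_one (x / 2)
  nlinarith

theorem fejer_le (x : ℝ) : fejer x ≤ 5 * (1 + x ^ 2)⁻¹ := by
  rw [← div_eq_mul_inv, le_div_iff₀ (by positivity)]
  exact fejer_mul_one_add_sq_le x

theorem integrable_fejer : Integrable fejer :=
  (integrable_inv_one_add_sq.const_mul 5).mono' continuous_fejer.aestronglyMeasurable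
    (.of_forall fun x => by
      rw [Real.norm_of_nonneg (fejer_nonneg x)]
      exact fejer_le x)

theorem tri_nonneg (t : ℝ) : 0 ≤ tri t := le_max_left _ _

theorem tri_le_one (t : ℝ) : tri t ≤ 1 := max_le zero_le_one (by linarith [abs_nonneg t])

theorem tri_eq_zero {t : ℝ} (ht : 1 ≤ |t|) : tri t = 0 := max_eq_left (by linarith)

theorem tri_zero : tri 0 = 1 := by simp [tri]

theorem abs_tri_sub_le (t t' : ℝ) : |tri t - tri t'| ≤ |t - t'| := by
  refine (abs_max_sub_max_le_max _ _ _ _).trans ?_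
  rw [sub_self, abs_zero, show 1 - |t| - (1 - |t'|) = |t'| - |t| by ring, abs_sub_comm t t']
  exact max_le (abs_nonneg _) (abs_abs_sub_abs_le_abs_sub _ _)

theorem integrable_tri : Integrable fun t => (tri t : ℂ) := by
  refine (Complex.continuous_ofReal.comp continuous_tri).integrable_of_hasCompactSupport
    (HasCompactSupport.intro (isCompact_Icc (a := -1) (b := 1)) fun t ht => ?_)
  rw [Function.comp, tri_eq_zero, Complex.ofReal_zero]
  by_contra! h
  exact ht ⟨(abs_lt.1 h).1.le, (abs_lt.1 h).2.le⟩

theorem hasDerivAt_one_sub_mul_exp {c : ℂ} (hc : c ≠ 0) (t : ℝ) :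
    HasDerivAt (fun t : ℝ => (1 - (t : ℂ)) * Complex.exp (c * t) / c + Complex.exp (c * t) / c ^ 2)
      ((1 - (t : ℂ)) * Complex.exp (c * t)) t := by
  have h1 : HasDerivAt (fun t : ℝ => Complex.exp (c * t)) (Complex.exp (c * t) * c) t := by
    have := ((hasDerivAt_id t).ofReal_comp.const_mul c).cexp
    simpa using this
  have h2 : HasDerivAt (fun t : ℝ => 1 - (t : ℂ)) (-1) t := by
    simpa using (hasDerivAt_id t).ofReal_comp.const_sub (1 : ℂ)
  refine (((h2.mul h1).div_const c).add (h1.div_const (c ^ 2))).congr_deriv ?_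
  field_simp
  ring

theorem integral_one_sub_mul_exp {c : ℂ} (hc : c ≠ 0) :
    ∫ t : ℝ in (0)..1, (1 - (t : ℂ)) * Complex.exp (c * t) =
      Complex.exp c / c ^ 2 - (1 / c + 1 / c ^ 2) := by
  rw [intervalIntegral.integral_eq_sub_of_hasDerivAt
    (fun t _ => hasDerivAt_one_sub_mul_exp hc t)
    (Continuous.intervalIntegrable (by fun_prop) _ _)]
  simp

/-- An explicit primitive gives the integral for `x ≠ 0`; the value at `0` follows because both
sides are continuous. -/
theorem ft_tri (x : ℝ) : ft (fun t => (tri t : ℂ)) x = (fejer x : ℂ) := by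
  have hcont : Continuous fun x : ℝ => (fejer x : ℂ) :=
    Complex.continuous_ofReal.comp continuous_fejer
  refine congrFun (Continuous.ext_on (dense_compl_singleton (0 : ℝ)) (continuous_ft integrable_tri)
    hcont fun x hx => ?_) x
  have hx0 : x ≠ 0 := hx
  have hpos : ∀ t : ℝ, 0 ≤ t → t ≤ 1 → tri t = 1 - t := fun t h0 h1 => by
    rw [tri, abs_of_nonneg h0, max_eq_right (by linarith)]
  have hneg : ∀ t : ℝ, tri (-t) = tri t := fun t => by rw [tri, tri, abs_neg]
  have hc : -(Complex.I * x) ≠ 0 := by simp [hx0]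
  have hi : ∀ a b : ℝ, IntervalIntegrable
      (fun t : ℝ => (tri t : ℂ) * Complex.exp (-(Complex.I * x * t))) volume a b := fun a b => by
    have := continuous_tri
    exact Continuous.intervalIntegrable (by fun_prop) _ _
  have h0 : ft (fun t => (tri t : ℂ)) x =
      ∫ t in (-1 : ℝ)..1, (tri t : ℂ) * Complex.exp (-(Complex.I * x * t)) := by
    rw [intervalIntegral.integral_of_le (by norm_num), ft]
    refine (setIntegral_eq_integral_of_forall_compl_eq_zero fun t ht => ?_).symm
    rw [tri_eq_zero, Complex.ofReal_zero, zero_mul]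
    by_contra! h
    exact ht ⟨(abs_lt.1 h).1, (abs_lt.1 h).2.le⟩
  have h1 : ∫ t in (0 : ℝ)..1, (tri t : ℂ) * Complex.exp (-(Complex.I * x * t)) =
      ∫ t : ℝ in (0)..1, (1 - (t : ℂ)) * Complex.exp (-(Complex.I * x) * t) := by
    refine intervalIntegral.integral_congr fun t ht => ?_
    rw [Set.uIcc_of_le zero_le_one] at ht
    simp only [hpos t ht.1 ht.2]
    push_cast
    congr 2
    ring
  have h2 : ∫ t in (-1 : ℝ)..0, (tri t : ℂ) * Complex.exp (-(Complex.I * x * t)) =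
      ∫ t : ℝ in (0)..1, (1 - (t : ℂ)) * Complex.exp (Complex.I * x * t) := by
    have h3 := intervalIntegral.integral_comp_neg (a := 0) (b := 1)
      (f := fun t : ℝ => (tri t : ℂ) * Complex.exp (-(Complex.I * x * t)))
    rw [neg_zero] at h3
    rw [← h3]
    refine intervalIntegral.integral_congr fun t ht => ?_
    rw [Set.uIcc_of_le zero_le_one] at ht
    simp only [hneg, hpos t ht.1 ht.2]
    push_cast
    congr 2
    ring
  rw [h0, ← intervalIntegral.integral_add_adjacent_intervals (hi (-1) 0) (hi 0 1), h1, h2,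
    integral_one_sub_mul_exp hc, integral_one_sub_mul_exp (by simpa using hc)]
  have h4 : (fejer x : ℂ) = ((2 - 2 * Real.cos x : ℝ) : ℂ) / x ^ 2 := by
    have : fejer x = (2 - 2 * Real.cos x) / x ^ 2 := by
      rw [eq_div_iff (by positivity), fejer_mul_sq]
      have := Real.cos_sq' (x / 2)
      have h5 := Real.cos_two_mul (x / 2)
      rw [show 2 * (x / 2) = x by ring] at h5
      linarith
    rw [this]
    push_cast
    rfl
  have hxc : (x : ℂ) ≠ 0 := by exact_mod_cast hx0
  have hI2 : (Complex.I * (x : ℂ)) ^ 2 = -(x : ℂ) ^ 2 := by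
    rw [mul_pow, Complex.I_sq]; ring
  have h6 : ((Real.cos x : ℝ) : ℂ) =
      (Complex.exp (Complex.I * x) + Complex.exp (-(Complex.I * x))) / 2 := by
    rw [Complex.ofReal_cos, Complex.cos]
    congr 3 <;> ring
  rw [h4]
  push_cast
  rw [neg_sq, hI2, show Complex.cos (x : ℂ) = ((Real.cos x : ℝ) : ℂ) by push_cast; rfl, h6]
  field_simp
  ring

/-- Fourier inversion applied to `ft_tri` at `-t`; the `x⁻²` decay of the kernel makes it
applicable. -/
theorem ft_fejer (t : ℝ) : ft (fun x => (fejer x : ℂ)) t = ((2 * Real.pi * tri t : ℝ) : ℂ) := by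
  have hF : 𝓕 (fun t => (tri t : ℂ)) = fun w => (fejer (2 * Real.pi * w) : ℂ) := by
    funext w
    rw [fourier_eq_ft, ft_tri]
  have hFi : Integrable (𝓕 (fun t => (tri t : ℂ))) := by
    rw [hF]
    exact (integrable_fejer.comp_mul_left' (R := 2 * Real.pi) (by positivity)).ofReal
  have h := congrFun (Continuous.fourierInv_fourier_eq
    (Complex.continuous_ofReal.comp continuous_tri) integrable_tri hFi) (-t)
  rw [Real.fourierInv_eq_fourier_neg, neg_neg,
    show Complex.ofReal ∘ tri = fun t => (tri t : ℂ) from rfl, hF, fourier_eq_ft, ft] at h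
  have h2 := Measure.integral_comp_mul_left
    (fun x : ℝ => (fejer x : ℂ) * Complex.exp (-(Complex.I * t * x))) (2 * Real.pi)
  have h3 : ∀ x : ℝ, Complex.exp (-(Complex.I * ((2 * Real.pi * t : ℝ) : ℂ) * x)) =
      Complex.exp (-(Complex.I * t * ((2 * Real.pi * x : ℝ) : ℂ))) := fun x => by
    congr 1
    push_cast
    ring
  simp_rw [h3] at h
  rw [h2, abs_of_pos (by positivity), ← ft] at h
  have h4 : tri (-t) = tri t := by rw [tri, tri, abs_neg]
  rw [h4] at h
  rw [Complex.ofReal_mul, ← h, Complex.real_smul]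
  have : ((2 * Real.pi : ℝ) : ℂ) ≠ 0 := by
    exact_mod_cast (by positivity : (2 * Real.pi : ℝ) ≠ 0)
  push_cast at this ⊢
  field_simp

theorem ft_comp_mul_sub (v : ℝ → ℂ) {r : ℝ} (hr : 0 < r) (a t : ℝ) :
    ft (fun x => v (r * (x - a))) t =
      Complex.exp (-(Complex.I * t * a)) * (r : ℂ)⁻¹ * ft v (t / r) := by
  have h1 := integral_sub_right_eq_self (μ := volume)
    (fun x : ℝ => v (r * x) * Complex.exp (-(Complex.I * t * (x + a : ℝ)))) a
  have h2 := Measure.integral_comp_mul_left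
    (fun x : ℝ => v x * Complex.exp (-(Complex.I * (t / r : ℝ) * x))) r
  have hr' : (r : ℂ) ≠ 0 := by exact_mod_cast hr.ne'
  rw [ft, ft]
  simp only [sub_add_cancel] at h1
  rw [h1]
  have h3 : ∀ x : ℝ, v (r * x) * Complex.exp (-(Complex.I * t * (x + a : ℝ))) =
      Complex.exp (-(Complex.I * t * a)) *
        (v (r * x) * Complex.exp (-(Complex.I * (t / r : ℝ) * (r * x : ℝ)))) := fun x => by
    rw [mul_left_comm, ← Complex.exp_add]
    congr 2
    push_cast
    field_simp
    ring
  simp_rw [h3]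
  rw [integral_const_mul, h2, abs_of_pos (inv_pos.2 hr), Complex.real_smul]
  push_cast
  ring

theorem ft_add {u v : ℝ → ℂ} (hu : Integrable u) (hv : Integrable v) (t : ℝ) :
    ft (fun x => u x + v x) t = ft u t + ft v t := by
  rw [ft, ft, ft, ← integral_add (integrable_mul_exp hu t) (integrable_mul_exp hv t)]
  exact integral_congr_ae (.of_forall fun x => by simp only; ring)

theorem ft_const_mul (c : ℂ) (u : ℝ → ℂ) (t : ℝ) :
    ft (fun x => c * u x) t = c * ft u t := by
  rw [ft, ft, ← integral_const_mul]
  exact integral_congr_ae (.of_forall fun x => by simp only; ring)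

/-! ### The perturbations. -/

/-- A modulated Fejér kernel, with Fourier transform supported in `2 ≤ |t| ≤ 4`. -/
def modFejer (y : ℝ) : ℝ := fejer y * Real.cos (3 * y)

theorem continuous_modFejer : Continuous modFejer :=
  continuous_fejer.mul (by fun_prop)

theorem modFejer_zero : modFejer 0 = 1 := by simp [modFejer, fejer_zero]

theorem abs_modFejer_le (y : ℝ) : |modFejer y| ≤ 5 * (1 + y ^ 2)⁻¹ := by
  rw [modFejer, abs_mul, abs_of_nonneg (fejer_nonneg y)]
  exact (mul_le_of_le_one_right (fejer_nonneg y) (Real.abs_cos_le_one _)).trans (fejer_le y)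

theorem abs_modFejer_le_half {y : ℝ} (hy : 3 ≤ |y|) : |modFejer y| ≤ 1 / 2 := by
  refine (abs_modFejer_le y).trans ?_
  have : 9 ≤ y ^ 2 := by rw [← sq_abs]; nlinarith
  rw [← div_eq_mul_inv, div_le_div_iff₀ (by positivity) (by norm_num)]
  linarith

theorem ft_modFejer (t : ℝ) :
    ft (fun y => (modFejer y : ℂ)) t = ((Real.pi * (tri (t - 3) + tri (t + 3)) : ℝ) : ℂ) := by
  have hi : Integrable fun x => (fejer x : ℂ) := integrable_fejer.ofReal
  have h : ∀ y : ℝ, (modFejer y : ℂ) * Complex.exp (-(Complex.I * t * y)) =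
      (1 / 2) * ((fejer y : ℂ) * Complex.exp (-(Complex.I * (t - 3 : ℝ) * y)) +
        (fejer y : ℂ) * Complex.exp (-(Complex.I * (t + 3 : ℝ) * y))) := fun y => by
    rw [modFejer]
    push_cast
    rw [show -(Complex.I * ((t : ℂ) - 3) * y) = -(Complex.I * t * y) + 3 * y * Complex.I by ring,
      show -(Complex.I * ((t : ℂ) + 3) * y) = -(Complex.I * t * y) + -(3 * y) * Complex.I by ring,
      Complex.exp_add, Complex.exp_add, Complex.cos]
    ring
  rw [ft]
  simp_rw [h]
  rw [integral_const_mul, integral_add (integrable_mul_exp hi _) (integrable_mul_exp hi _),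
    ← ft, ← ft, ft_fejer, ft_fejer]
  push_cast
  ring

/-- The perturbation `x ↦ A G(r (x - a))` with `G` the modulated Fejér kernel. -/
def bump (A r a x : ℝ) : ℝ := A * modFejer (r * (x - a))

theorem continuous_bump (A r a : ℝ) : Continuous (bump A r a) :=
  continuous_const.mul (continuous_modFejer.comp (by fun_prop))

/-- As `|a| ≤ 1`, `x² ≤ 2(x - a)² + 2a²` gives `1 + x² ≤ 3(1 + (x - a)²)`: all bumps share one
envelope, which the base density can dominate. -/
theorem abs_bump_le {A r a : ℝ} (hA : 0 ≤ A) (hr : 1 ≤ r) (ha : |a| ≤ 1) (x : ℝ) :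
    |bump A r a x| ≤ 15 * A * (1 + x ^ 2)⁻¹ := by
  rw [bump, abs_mul, abs_of_nonneg hA]
  have h1 := abs_modFejer_le (r * (x - a))
  have h2 : (1 + (r * (x - a)) ^ 2)⁻¹ ≤ 3 * (1 + x ^ 2)⁻¹ := by
    rw [← div_eq_mul_inv, inv_eq_one_div, div_le_div_iff₀ (by positivity) (by positivity)]
    have h3 : (x - a) ^ 2 ≤ (r * (x - a)) ^ 2 := by
      rw [mul_pow]
      exact le_mul_of_one_le_left (sq_nonneg _) (one_le_pow₀ hr)
    have h4 : a ^ 2 ≤ 1 := by rwa [sq_le_one_iff_abs_le_one]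
    nlinarith [sq_nonneg (x - 2 * a)]
  calc A * |modFejer (r * (x - a))| ≤ A * (5 * (3 * (1 + x ^ 2)⁻¹)) := by gcongr; linarith
    _ = _ := by ring

theorem integrable_of_le_inv_one_add_sq {f : ℝ → ℝ} (hf : Continuous f) {c : ℝ}
    (h : ∀ x, |f x| ≤ c * (1 + x ^ 2)⁻¹) : Integrable f :=
  (integrable_inv_one_add_sq.const_mul c).mono' hf.aestronglyMeasurable (.of_forall h)

theorem ft_bump {A r a : ℝ} (hr : 0 < r) (t : ℝ) :
    ft (fun x => (bump A r a x : ℂ)) t = ((A * r⁻¹ * Real.pi : ℝ) : ℂ) *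
      (Complex.exp (-(Complex.I * a * t)) * ((tri (t / r - 3) + tri (t / r + 3) : ℝ) : ℂ)) := by
  have h := ft_comp_mul_sub (fun y => (modFejer y : ℂ)) hr a t
  simp only [bump, Complex.ofReal_mul]
  rw [ft_const_mul, h, ft_modFejer]
  push_cast
  rw [show Complex.I * (t : ℂ) * a = Complex.I * a * t by ring]
  ring

theorem tri_add_tri_eq_zero {t : ℝ} (ht : |t| ≤ 2 ∨ 4 ≤ |t|) : tri (t - 3) + tri (t + 3) = 0 := by
  have h : 1 ≤ |t - 3| ∧ 1 ≤ |t + 3| := by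
    rcases ht with h | h
    · rw [abs_le] at h
      rw [le_abs, le_abs]
      exact ⟨.inr (by linarith), .inl (by linarith)⟩
    · rw [le_abs] at h
      simp only [le_abs]
      rcases h with h | h
      · exact ⟨.inl (by linarith), .inl (by linarith)⟩
      · exact ⟨.inr (by linarith), .inr (by linarith)⟩
  rw [tri_eq_zero h.1, tri_eq_zero h.2, add_zero]

theorem ft_bump_eq_zero {A r a : ℝ} (hr : 0 < r) {t : ℝ} (ht : |t| ≤ 2 * r ∨ 4 * r ≤ |t|) :
    ft (fun x => (bump A r a x : ℂ)) t = 0 := by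
  rw [ft_bump hr, tri_add_tri_eq_zero, Complex.ofReal_zero, mul_zero, mul_zero]
  rw [abs_div, abs_of_pos hr, div_le_iff₀ hr, le_div_iff₀ hr]
  exact ht

theorem norm_ft_bump_le {A r a : ℝ} (hA : 0 ≤ A) (hr : 0 < r) (t : ℝ) :
    ‖ft (fun x => (bump A r a x : ℂ)) t‖ ≤ 8 * A * r⁻¹ := by
  rw [ft_bump hr, norm_mul, norm_mul, norm_exp_neg_I_mul, one_mul, Complex.norm_real,
    Complex.norm_real, Real.norm_of_nonneg (by positivity),
    Real.norm_of_nonneg (add_nonneg (tri_nonneg _) (tri_nonneg _))]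
  have h1 := tri_le_one (t / r - 3)
  have h2 := tri_le_one (t / r + 3)
  calc A * r⁻¹ * Real.pi * (tri (t / r - 3) + tri (t / r + 3)) ≤ A * r⁻¹ * 4 * (1 + 1) := by
        gcongr
        · exact add_nonneg (tri_nonneg _) (tri_nonneg _)
        · exact Real.pi_le_four
    _ = _ := by ring

theorem norm_exp_sub_exp_le (a t t' : ℝ) :
    ‖Complex.exp (-(Complex.I * a * t)) - Complex.exp (-(Complex.I * a * t'))‖ ≤
      |a| * |t - t'| := by
  have h : Complex.exp (-(Complex.I * a * t)) - Complex.exp (-(Complex.I * a * t')) =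
      Complex.exp (-(Complex.I * a * t')) *
        (Complex.exp (Complex.I * ((-(a * (t - t')) : ℝ) : ℂ)) - 1) := by
    rw [mul_sub, ← Complex.exp_add, mul_one]
    congr 2
    push_cast
    ring
  rw [h, norm_mul, norm_exp_neg_I_mul, one_mul]
  refine Real.norm_exp_I_mul_ofReal_sub_one_le.trans_eq ?_
  rw [Real.norm_eq_abs, abs_neg, abs_mul]

/-- The modulation by `e^{-iat}` has Lipschitz constant `|a| ≤ 1` and the two triangles have slope
`1/r ≤ 1`. So the constant is of the same order `A/r` as the sup bound: centres in a bounded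
interval lose nothing in the weighted norm. -/
theorem norm_ft_bump_sub_le {A r a : ℝ} (hA : 0 ≤ A) (hr : 1 ≤ r) (ha : |a| ≤ 1) (t t' : ℝ) :
    ‖ft (fun x => (bump A r a x : ℂ)) t - ft (fun x => (bump A r a x : ℂ)) t'‖ ≤
      16 * A * r⁻¹ * |t - t'| := by
  have hr0 : 0 < r := by linarith
  rw [ft_bump hr0, ft_bump hr0, ← mul_sub, norm_mul, Complex.norm_real,
    Real.norm_of_nonneg (by positivity)]
  set T := fun t => tri (t / r - 3) + tri (t / r + 3) with hT
  have hT1 : |T t - T t'| ≤ 2 * |t - t'| := by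
    have h1 := abs_tri_sub_le (t / r - 3) (t' / r - 3)
    have h2 := abs_tri_sub_le (t / r + 3) (t' / r + 3)
    rw [show t / r - 3 - (t' / r - 3) = (t - t') / r by ring, abs_div, abs_of_pos hr0] at h1
    rw [show t / r + 3 - (t' / r + 3) = (t - t') / r by ring, abs_div, abs_of_pos hr0] at h2
    have h3 : |t - t'| / r ≤ |t - t'| := div_le_self (abs_nonneg _) hr
    rw [show T t - T t' = (tri (t / r - 3) - tri (t' / r - 3)) +
      (tri (t / r + 3) - tri (t' / r + 3)) by simp only [hT]; ring]
    refine (abs_add_le _ _).trans ?_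
    linarith
  have hT2 : |T t'| ≤ 2 := by
    rw [abs_of_nonneg (add_nonneg (tri_nonneg _) (tri_nonneg _))]
    have h1 := tri_le_one (t' / r - 3)
    have h2 := tri_le_one (t' / r + 3)
    change tri (t' / r - 3) + tri (t' / r + 3) ≤ 2
    linarith
  have h : ‖Complex.exp (-(Complex.I * a * t)) * (T t : ℂ) -
      Complex.exp (-(Complex.I * a * t')) * (T t' : ℂ)‖ ≤ 4 * |t - t'| := by
    rw [show Complex.exp (-(Complex.I * a * t)) * (T t : ℂ) -
      Complex.exp (-(Complex.I * a * t')) * (T t' : ℂ) =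
      Complex.exp (-(Complex.I * a * t)) * ((T t - T t' : ℝ) : ℂ) +
      (Complex.exp (-(Complex.I * a * t)) - Complex.exp (-(Complex.I * a * t'))) * (T t' : ℂ) by
      push_cast; ring]
    refine (norm_add_le _ _).trans ?_
    rw [norm_mul, norm_mul, norm_exp_neg_I_mul, one_mul, Complex.norm_real, Complex.norm_real,
      Real.norm_eq_abs, Real.norm_eq_abs]
    have h1 : |a| * |t - t'| ≤ 1 * |t - t'| := by gcongr
    have h2 := mul_le_mul ((norm_exp_sub_exp_le a t t').trans h1) hT2 (abs_nonneg _)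
      (by positivity)
    linarith
  calc A * r⁻¹ * Real.pi * _ ≤ A * r⁻¹ * 4 * (4 * |t - t'|) := by
        gcongr
        exact Real.pi_le_four
    _ = _ := by ring

/-! ### The base density. -/

/-- A band-limited probability density with tails of exact order `x⁻²`. -/
def baseDensity (σ x : ℝ) : ℝ :=
  σ / (4 * Real.pi) * (fejer (σ * x) + fejer (σ * (x - Real.pi / σ)))

theorem continuous_baseDensity (σ : ℝ) : Continuous (baseDensity σ) :=
  continuous_const.mul ((continuous_fejer.comp (by fun_prop)).add
    (continuous_fejer.comp (by fun_prop)))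

/-- The shift by `π` turns `sin²(y/2)` into `cos²(y/2)`, so the zeros of one kernel are compensated
by the other and the sum keeps the full `y⁻²` tail. -/
theorem le_fejer_add_fejer (y : ℝ) :
    (Real.pi ^ 2)⁻¹ * (1 + y ^ 2)⁻¹ ≤ fejer y + fejer (y - Real.pi) := by
  have h1 := fejer_mul_sq y
  have h2 := fejer_mul_sq (y - Real.pi)
  rw [show (y - Real.pi) / 2 = y / 2 - Real.pi / 2 by ring, Real.sin_sub_pi_div_two, neg_sq] at h2
  have h3 := Real.sin_sq_add_cos_sq (y / 2)
  have h4 : y ^ 2 ≤ 4 * Real.pi ^ 2 * (1 + y ^ 2) := by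
    nlinarith [Real.pi_gt_three, sq_nonneg y,
      mul_nonneg (sq_nonneg y) (by nlinarith [Real.pi_gt_three] : 0 ≤ Real.pi ^ 2 - 1)]
  have h5 : (y - Real.pi) ^ 2 ≤ 4 * Real.pi ^ 2 * (1 + y ^ 2) := by
    nlinarith [Real.pi_gt_three, sq_nonneg y, sq_nonneg (y + Real.pi),
      mul_nonneg (sq_nonneg y) (by nlinarith [Real.pi_gt_three] : 0 ≤ Real.pi ^ 2 - 1)]
  have h6 := mul_le_mul_of_nonneg_left h4 (fejer_nonneg y)
  have h7 := mul_le_mul_of_nonneg_left h5 (fejer_nonneg (y - Real.pi))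
  rw [← mul_inv, inv_le_iff_one_le_mul₀ (by positivity)]
  nlinarith

theorem le_baseDensity {σ : ℝ} (h0 : 0 < σ) (h1 : σ ≤ 1) (x : ℝ) :
    σ / (4 * Real.pi) * (Real.pi ^ 2)⁻¹ * (1 + x ^ 2)⁻¹ ≤ baseDensity σ x := by
  have h := le_fejer_add_fejer (σ * x)
  rw [baseDensity, mul_assoc, show σ * (x - Real.pi / σ) = σ * x - Real.pi by field_simp]
  gcongr
  refine le_trans ?_ h
  have h2 : (σ * x) ^ 2 ≤ x ^ 2 := by
    rw [mul_pow]
    exact mul_le_of_le_one_left (sq_nonneg _) (pow_le_one₀ h0.le h1)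
  gcongr

theorem integrable_baseDensity {σ : ℝ} (h0 : 0 < σ) : Integrable (baseDensity σ) :=
  ((integrable_fejer.comp_mul_left' h0.ne').add
    ((integrable_fejer.comp_mul_left' h0.ne').comp_sub_right (Real.pi / σ))).const_mul _

theorem baseDensity_le {σ : ℝ} (h0 : 0 < σ) (x : ℝ) : baseDensity σ x ≤ σ := by
  have h1 := fejer_le_one (σ * x)
  have h2 := fejer_le_one (σ * (x - Real.pi / σ))
  calc baseDensity σ x ≤ σ / (4 * Real.pi) * (1 + 1) := by rw [baseDensity]; gcongr
    _ = σ / (2 * Real.pi) := by field_simp; norm_num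
    _ ≤ σ := div_le_self h0.le (by linarith [Real.pi_gt_three])

theorem ft_baseDensity {σ : ℝ} (h0 : 0 < σ) (t : ℝ) :
    ft (fun x => (baseDensity σ x : ℂ)) t =
      ((1 / 2 : ℝ) : ℂ) * ((1 + Complex.exp (-(Complex.I * t * (Real.pi / σ : ℝ)))) *
        (tri (t / σ) : ℂ)) := by
  have hi := integrable_fejer.comp_mul_left' h0.ne'
  have h1 := ft_comp_mul_sub (fun y => (fejer y : ℂ)) h0 0 t
  have h2 := ft_comp_mul_sub (fun y => (fejer y : ℂ)) h0 (Real.pi / σ) t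
  simp only [sub_zero] at h1
  simp only [baseDensity, Complex.ofReal_mul, Complex.ofReal_add]
  have hi1 : Integrable fun x => (fejer (σ * x) : ℂ) := hi.ofReal
  have hi2 : Integrable fun x => (fejer (σ * (x - Real.pi / σ)) : ℂ) :=
    (hi.comp_sub_right (Real.pi / σ)).ofReal
  rw [ft_const_mul, ft_add hi1 hi2]
  rw [h1, h2, ft_fejer]
  have h3 : (σ : ℂ) ≠ 0 := by exact_mod_cast h0.ne'
  have h4 : (Real.pi : ℂ) ≠ 0 := by exact_mod_cast Real.pi_ne_zero
  rw [Complex.ofReal_zero, mul_zero, neg_zero, Complex.exp_zero]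
  push_cast
  field_simp
  ring

theorem norm_ft_baseDensity_le {σ : ℝ} (h0 : 0 < σ) (t : ℝ) :
    ‖ft (fun x => (baseDensity σ x : ℂ)) t‖ ≤ 1 := by
  rw [ft_baseDensity h0, norm_mul, norm_mul, Complex.norm_real, Complex.norm_real,
    Real.norm_of_nonneg (tri_nonneg _), Real.norm_of_nonneg (by norm_num)]
  have h1 : ‖1 + Complex.exp (-(Complex.I * t * (Real.pi / σ : ℝ)))‖ ≤ 2 := by
    refine (norm_add_le _ _).trans_eq ?_
    rw [norm_exp_neg_I_mul, norm_one]
    norm_num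
  have h2 := mul_le_mul h1 (tri_le_one (t / σ)) (tri_nonneg _) zero_le_two
  linarith

theorem ft_baseDensity_eq_zero {σ : ℝ} (h0 : 0 < σ) {t : ℝ} (ht : σ ≤ |t|) :
    ft (fun x => (baseDensity σ x : ℂ)) t = 0 := by
  rw [ft_baseDensity h0, tri_eq_zero, Complex.ofReal_zero, mul_zero, mul_zero]
  rwa [abs_div, abs_of_pos h0, one_le_div h0]

theorem integral_eq_of_ft_zero {f : ℝ → ℝ} {c : ℝ} (h : ft (fun x => (f x : ℂ)) 0 = c) :
    ∫ x, f x = c := by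
  rw [ft] at h
  simp only [Complex.ofReal_zero, mul_zero, zero_mul, neg_zero, Complex.exp_zero, mul_one] at h
  exact Complex.ofReal_injective (integral_complex_ofReal.symm.trans h)

theorem integral_baseDensity {σ : ℝ} (h0 : 0 < σ) : ∫ x, baseDensity σ x = 1 := by
  refine integral_eq_of_ft_zero ?_
  rw [ft_baseDensity h0]
  simp [tri_zero]
  norm_num

theorem integral_bump {A r a : ℝ} (hr : 0 < r) : ∫ x, bump A r a x = 0 := by
  refine integral_eq_of_ft_zero ?_
  rw [ft_bump_eq_zero hr (.inl (by simpa using hr.le)), Complex.ofReal_zero]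

/-! ### Meyer coefficients and the Besov norm of band-limited functions. -/

/-- The bound on a scaling or wavelet coefficient of `f` at level `l` obtained from Parseval's
formula. -/
def coeffBound (h : ℝ → ℂ) (f : ℝ → ℝ) (l : ℕ) : ℝ :=
  (2 : ℝ) ^ ((l : ℝ) / 2) / (2 * Real.pi) *
    ∫ ξ, ‖h ξ‖ * ‖ft (fun x => (f x : ℂ)) (-((2 : ℝ) ^ l * ξ))‖

/-- Fubini turns the coefficient into a frequency integral where the translation `k` appears only as
a phase; the bound is therefore uniform in `k`. -/
theorem abs_integral_mul_dilTrans_le {h : ℝ → ℂ} (hh : Integrable h) {f : ℝ → ℝ}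
    (hf : Integrable f) (l : ℕ) (k : ℤ) :
    |∫ x, f x * dilTrans (realInvFourier h) l k x| ≤ coeffBound h f l := by
  set c : ℝ := (2 : ℝ) ^ ((l : ℝ) / 2) / (2 * Real.pi) with hc
  have hc0 : 0 ≤ c := by positivity
  set F : ℝ → ℝ → ℂ := fun x ξ =>
    (f x : ℂ) * (h ξ * Complex.exp (Complex.I * ξ * ((2 : ℝ) ^ l * x - k : ℝ))) with hF
  have hFi : Integrable (Function.uncurry F) (volume.prod volume) := by
    have h1 : Integrable (fun z : ℝ × ℝ => (f z.1 : ℂ) * h z.2) (volume.prod volume) :=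
      (hf.ofReal (𝕜 := ℂ)).mul_prod hh
    have h2 : Continuous fun z : ℝ × ℝ =>
        Complex.exp (Complex.I * z.2 * ((2 : ℝ) ^ l * z.1 - k : ℝ)) := by fun_prop
    refine (h1.mul_bdd (c := 1) h2.aestronglyMeasurable (.of_forall fun z => ?_)).congr
      (.of_forall fun z => ?_)
    · rw [mul_assoc, mul_comm Complex.I, ← Complex.ofReal_mul, Complex.norm_exp_ofReal_mul_I]
    · simp only [hF, Function.uncurry]
      ring
  have h1 : ∀ x, f x * dilTrans (realInvFourier h) l k x = ((c : ℂ) * ∫ ξ, F x ξ).re := by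
    intro x
    simp only [hF, dilTrans, realInvFourier, hc]
    rw [integral_const_mul, ← Complex.re_ofReal_mul, ← Complex.re_ofReal_mul]
    congr 1
    push_cast
    ring
  have h2 : ∫ x, f x * dilTrans (realInvFourier h) l k x = ((c : ℂ) * ∫ x, ∫ ξ, F x ξ).re := by
    simp_rw [h1]
    rw [← integral_const_mul]
    exact integral_re (hFi.integral_prod_left.const_mul (c : ℂ))
  have h3 : ∀ ξ, ‖∫ x, F x ξ‖ = ‖h ξ‖ * ‖ft (fun x => (f x : ℂ)) (-((2 : ℝ) ^ l * ξ))‖ := by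
    intro ξ
    have h4 : ∀ x, F x ξ = h ξ * Complex.exp (Complex.I * ((-(ξ * k) : ℝ) : ℂ)) *
        ((f x : ℂ) * Complex.exp (-(Complex.I * ((-((2 : ℝ) ^ l * ξ) : ℝ) : ℂ) * x))) := by
      intro x
      simp only [hF]
      rw [show Complex.I * (ξ : ℂ) * (((2 : ℝ) ^ l * x - k : ℝ) : ℂ) =
        Complex.I * ((-(ξ * k) : ℝ) : ℂ) + -(Complex.I * ((-((2 : ℝ) ^ l * ξ) : ℝ) : ℂ) * x) by
        push_cast; ring, Complex.exp_add]
      ring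
    simp_rw [h4]
    rw [integral_const_mul, ← ft, norm_mul, norm_mul, mul_comm Complex.I,
      Complex.norm_exp_ofReal_mul_I, mul_one]
  rw [h2, integral_integral_swap hFi]
  refine (Complex.abs_re_le_norm _).trans ?_
  rw [norm_mul, Complex.norm_real, Real.norm_of_nonneg hc0, coeffBound, ← hc]
  refine mul_le_mul_of_nonneg_left ((norm_integral_le_integral_norm _).trans_eq ?_) hc0
  simp_rw [h3]

theorem coeffBound_add_le {h : ℝ → ℂ} (hh : Integrable h) {f g : ℝ → ℝ}
    (hf : Integrable f) (hg : Integrable g) (l : ℕ) :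
    coeffBound h (fun x => f x + g x) l ≤ coeffBound h f l + coeffBound h g l := by
  have hi : ∀ {u : ℝ → ℝ}, Integrable u → Integrable fun ξ =>
      ‖h ξ‖ * ‖ft (fun x => (u x : ℂ)) (-((2 : ℝ) ^ l * ξ))‖ := fun {u} hu =>
    hh.norm.mul_bdd (c := ∫ x, ‖(u x : ℂ)‖)
      (((continuous_ft hu.ofReal).comp (by fun_prop)).norm.aestronglyMeasurable)
      (.of_forall fun ξ => by
        rw [norm_norm]
        exact norm_ft_le _)
  rw [coeffBound, coeffBound, coeffBound, ← mul_add, ← integral_add (hi hf) (hi hg)]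
  refine mul_le_mul_of_nonneg_left ?_ (by positivity)
  refine integral_mono (hi (hf.add hg)) ((hi hf).add (hi hg)) fun ξ => ?_
  simp only [Complex.ofReal_add]
  have hf' : Integrable fun x => (f x : ℂ) := hf.ofReal
  have hg' : Integrable fun x => (g x : ℂ) := hg.ofReal
  rw [ft_add hf' hg', ← mul_add]
  exact mul_le_mul_of_nonneg_left (norm_add_le _ _) (norm_nonneg _)

theorem coeffBound_le {h : ℝ → ℂ} (h1 : ∀ ξ, ‖h ξ‖ ≤ 1) {f : ℝ → ℝ} {B R : ℝ} (hR : 0 ≤ R)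
    (hB : ∀ t, ‖ft (fun x => (f x : ℂ)) t‖ ≤ B)
    (hsupp : ∀ t, R ≤ |t| → ft (fun x => (f x : ℂ)) t = 0) (l : ℕ) :
    coeffBound h f l ≤ (2 : ℝ) ^ ((l : ℝ) / 2) * (B * R / 2 ^ l) := by
  have hB0 : 0 ≤ B := (norm_nonneg _).trans (hB 0)
  have h2l : (0 : ℝ) < 2 ^ l := by positivity
  have hint : ∫ ξ, ‖h ξ‖ * ‖ft (fun x => (f x : ℂ)) (-((2 : ℝ) ^ l * ξ))‖ ≤
      B * (2 * (R / 2 ^ l)) := by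
    have h3 : ∀ ξ, ‖h ξ‖ * ‖ft (fun x => (f x : ℂ)) (-((2 : ℝ) ^ l * ξ))‖ ≤
        (Set.Icc (-(R / 2 ^ l)) (R / 2 ^ l)).indicator (fun _ => B) ξ := by
      intro ξ
      by_cases hξ : ξ ∈ Set.Icc (-(R / 2 ^ l)) (R / 2 ^ l)
      · rw [Set.indicator_of_mem hξ]
        exact (mul_le_mul (h1 ξ) (hB _) (norm_nonneg _) zero_le_one).trans_eq (one_mul B)
      · rw [Set.indicator_of_notMem hξ, hsupp, norm_zero, mul_zero]
        rw [abs_neg, abs_mul, abs_of_pos h2l, ← div_le_iff₀' h2l]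
        by_contra! hlt
        exact hξ ⟨(abs_lt.1 hlt).1.le, (abs_lt.1 hlt).2.le⟩
    refine (integral_mono_of_nonneg (.of_forall fun ξ => by positivity)
      ((integrable_indicator_iff measurableSet_Icc).2
        (continuousOn_const.integrableOn_compact isCompact_Icc)) (.of_forall h3)).trans_eq ?_
    rw [integral_indicator measurableSet_Icc, setIntegral_const, Measure.real, Real.volume_Icc,
      ENNReal.toReal_ofReal (by linarith [div_nonneg hR h2l.le]), smul_eq_mul]
    ring
  rw [coeffBound]
  calc (2 : ℝ) ^ ((l : ℝ) / 2) / (2 * Real.pi) * _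
      ≤ (2 : ℝ) ^ ((l : ℝ) / 2) / (2 * Real.pi) * (B * (2 * (R / 2 ^ l))) := by gcongr
    _ = (2 : ℝ) ^ ((l : ℝ) / 2) * (B * R / 2 ^ l) / Real.pi := by field_simp
    _ ≤ _ := div_le_self (by positivity) (by linarith [Real.pi_gt_three])

theorem coeffBound_eq_zero {h : ℝ → ℂ} (h0 : ∀ ξ, |ξ| ≤ 2 → h ξ = 0) {f : ℝ → ℝ} {R : ℝ}
    (hsupp : ∀ t, R ≤ |t| → ft (fun x => (f x : ℂ)) t = 0) {l : ℕ} (hl : R ≤ 2 ^ l * 2) :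
    coeffBound h f l = 0 := by
  have : ∀ ξ, ‖h ξ‖ * ‖ft (fun x => (f x : ℂ)) (-((2 : ℝ) ^ l * ξ))‖ = 0 := by
    intro ξ
    rcases le_total |ξ| 2 with hξ | hξ
    · rw [h0 ξ hξ, norm_zero, zero_mul]
    · rw [hsupp, norm_zero, mul_zero]
      rw [abs_neg, abs_mul, abs_of_pos (by positivity : (0 : ℝ) < 2 ^ l)]
      exact hl.trans (by gcongr)
  simp [coeffBound, this]

theorem norm_meyerScalingHat_le (ν : ℝ → ℝ) (ξ : ℝ) : ‖meyerScalingHat ν ξ‖ ≤ 1 := by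
  unfold meyerScalingHat
  split_ifs
  · rw [Complex.norm_real]
    exact Real.abs_cos_le_one _
  · simp

theorem norm_meyerWaveletHat_le (ν : ℝ → ℝ) (ξ : ℝ) : ‖meyerWaveletHat ν ξ‖ ≤ 1 := by
  unfold meyerWaveletHat
  have : ‖Complex.exp (-(Complex.I * ξ / 2))‖ = 1 := by
    have := norm_exp_neg_I_mul ξ (1 / 2)
    rw [← this]
    congr 3
    push_cast
    ring
  rw [norm_mul, this, one_mul]
  split_ifs
  · rw [Complex.norm_real]
    exact Real.abs_sin_le_one _
  · rw [Complex.norm_real]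
    exact Real.abs_cos_le_one _
  · simp

/-- The wavelet's spectrum starts at `2π/3 > 2`. A function with spectrum in `[-2, 2]` thus has no
wavelet coefficients. -/
theorem meyerWaveletHat_eq_zero {ν : ℝ → ℝ} (hν : IsMeyerAux ν) {ξ : ℝ} (hξ : |ξ| ≤ 2) :
    meyerWaveletHat ν ξ = 0 := by
  have hπ := Real.pi_gt_three
  have h1 : |ξ| ≤ 4 * Real.pi / 3 := by linarith
  have h2 : 3 * |ξ| / (2 * Real.pi) - 1 ≤ 0 := by
    rw [sub_nonpos, div_le_one (by positivity)]
    linarith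
  rw [meyerWaveletHat, if_pos h1, hν.eq_zero _ h2]
  simp

theorem integrable_of_norm_le_one {h : ℝ → ℂ} (hm : Measurable h) (h1 : ∀ ξ, ‖h ξ‖ ≤ 1) {ρ : ℝ}
    (h0 : ∀ ξ, ρ < |ξ| → h ξ = 0) : Integrable h := by
  have hi : Integrable ((Set.Icc (-ρ) ρ).indicator fun _ => (1 : ℝ)) :=
    (integrable_indicator_iff measurableSet_Icc).2
      (continuousOn_const.integrableOn_compact isCompact_Icc)
  refine hi.mono' hm.aestronglyMeasurable (.of_forall fun ξ => ?_)
  by_cases hξ : ξ ∈ Set.Icc (-ρ) ρ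
  · rw [Set.indicator_of_mem hξ]
    exact h1 ξ
  · rw [Set.indicator_of_notMem hξ, h0, norm_zero]
    by_contra! h
    exact hξ (abs_le.1 h)

theorem integrable_meyerScalingHat {ν : ℝ → ℝ} (hν : IsMeyerAux ν) :
    Integrable (meyerScalingHat ν) := by
  have hm := hν.contDiff.continuous.measurable
  refine integrable_of_norm_le_one (ρ := 4 * Real.pi / 3) ?_ (norm_meyerScalingHat_le ν)
    fun ξ hξ => if_neg hξ.not_ge
  exact Measurable.ite (measurableSet_le (by fun_prop) (by fun_prop)) (by fun_prop)
    measurable_const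

theorem integrable_meyerWaveletHat {ν : ℝ → ℝ} (hν : IsMeyerAux ν) :
    Integrable (meyerWaveletHat ν) := by
  have hm := hν.contDiff.continuous.measurable
  refine integrable_of_norm_le_one (ρ := 8 * Real.pi / 3) ?_ (norm_meyerWaveletHat_le ν)
    fun ξ hξ => ?_
  · exact Measurable.mul (by fun_prop) (Measurable.ite
      (measurableSet_le (by fun_prop) (by fun_prop)) (by fun_prop)
      (Measurable.ite (measurableSet_le (by fun_prop) (by fun_prop)) (by fun_prop)
        measurable_const))
  · have := Real.pi_pos
    rw [meyerWaveletHat, if_neg (by linarith), if_neg hξ.not_ge, mul_zero]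

/-- The Besov norm of the sum of a function with spectrum below the first wavelet level and of a
band-limited function. -/
theorem besovNorm_add_le {ν : ℝ → ℝ} (hν : IsMeyerAux ν) {s : ℝ} (hs : 0 < s) {f g : ℝ → ℝ}
    (hf : Integrable f) (hg : Integrable g) {B₁ R₁ B₂ R₂ : ℝ} (hR₁ : 0 ≤ R₁) (hR₁' : R₁ ≤ 2)
    (hR₂ : 0 ≤ R₂)
    (hB₁ : ∀ t, ‖ft (fun x => (f x : ℂ)) t‖ ≤ B₁)
    (hf0 : ∀ t, R₁ ≤ |t| → ft (fun x => (f x : ℂ)) t = 0)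
    (hB₂ : ∀ t, ‖ft (fun x => (g x : ℂ)) t‖ ≤ B₂)
    (hg0 : ∀ t, R₂ ≤ |t| → ft (fun x => (g x : ℂ)) t = 0) :
    besovNorm ν s (fun x => f x + g x) ≤
      ENNReal.ofReal (B₁ * R₁ + B₂ * R₂ + R₂ ^ s * (B₂ * R₂)) := by
  have hB₁0 : 0 ≤ B₁ := (norm_nonneg _).trans (hB₁ 0)
  have hB₂0 : 0 ≤ B₂ := (norm_nonneg _).trans (hB₂ 0)
  have hfg := hf.add hg
  have hα : ∀ k, |scalingCoeff ν (fun x => f x + g x) k| ≤ B₁ * R₁ + B₂ * R₂ := by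
    intro k
    refine (abs_integral_mul_dilTrans_le (integrable_meyerScalingHat hν) hfg 0 k).trans ?_
    refine (coeffBound_add_le (integrable_meyerScalingHat hν) hf hg 0).trans ?_
    have h1 := coeffBound_le (norm_meyerScalingHat_le ν) hR₁ hB₁ hf0 0
    have h2 := coeffBound_le (norm_meyerScalingHat_le ν) hR₂ hB₂ hg0 0
    norm_num at h1 h2
    linarith
  have hβ : ∀ (l : ℕ) (k : ℤ), (2 : ℝ) ^ ((l : ℝ) * (s + 1 / 2)) * |waveletCoeff ν (fun x => f x + g x) l k| ≤
      R₂ ^ s * (B₂ * R₂) := by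
    intro l k
    have h1 : |waveletCoeff ν (fun x => f x + g x) l k| ≤ coeffBound (meyerWaveletHat ν) g l := by
      refine (abs_integral_mul_dilTrans_le (integrable_meyerWaveletHat hν) hfg l k).trans ?_
      refine (coeffBound_add_le (integrable_meyerWaveletHat hν) hf hg l).trans ?_
      have h2l : (1 : ℝ) ≤ 2 ^ l := one_le_pow₀ (by norm_num)
      rw [coeffBound_eq_zero (fun ξ => meyerWaveletHat_eq_zero hν) hf0 (by linarith), zero_add]
    -- Only levels with `2^(l+1) < R₂` see `g`, and there `2^(ls) ≤ R₂^s`.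
    rcases le_or_gt R₂ (2 ^ l * 2) with hl | hl
    · rw [coeffBound_eq_zero (fun ξ => meyerWaveletHat_eq_zero hν) hg0 hl] at h1
      rw [le_antisymm h1 (abs_nonneg _), mul_zero]
      positivity
    · have h2 := h1.trans (coeffBound_le (norm_meyerWaveletHat_le ν) hR₂ hB₂ hg0 l)
      have h3 : (2 : ℝ) ^ ((l : ℝ) * (s + 1 / 2)) * ((2 : ℝ) ^ ((l : ℝ) / 2) *
          (B₂ * R₂ / 2 ^ l)) = ((2 : ℝ) ^ l) ^ s * (B₂ * R₂) := by
        rw [← mul_assoc, ← Real.rpow_add two_pos,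
          show (l : ℝ) * (s + 1 / 2) + (l : ℝ) / 2 = (l : ℝ) * s + l by ring,
          Real.rpow_add two_pos, Real.rpow_mul two_pos.le, Real.rpow_natCast]
        field_simp
      calc _ ≤ (2 : ℝ) ^ ((l : ℝ) * (s + 1 / 2)) * ((2 : ℝ) ^ ((l : ℝ) / 2) *
            (B₂ * R₂ / 2 ^ l)) := by gcongr
        _ = ((2 : ℝ) ^ l) ^ s * (B₂ * R₂) := h3
        _ ≤ _ := by
          gcongr
          have : (0 : ℝ) < 2 ^ l := by positivity
          linarith
  rw [besovNorm, ENNReal.ofReal_add (by positivity) (by positivity)]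
  refine add_le_add (iSup_le fun k => ENNReal.ofReal_le_ofReal (hα k)) (iSup_le fun l => ?_)
  rw [ENNReal.mul_iSup]
  refine iSup_le fun k => ?_
  rw [← ENNReal.ofReal_mul (by positivity)]
  exact ENNReal.ofReal_le_ofReal (hβ l k)

/-! ### Convolution with the error law. -/

/-- The density `f * φ` of an observation. -/
def convDens (f : ℝ → ℝ) (φ : Measure ℝ) (x : ℝ) : ℝ := ∫ y, f (x - y) ∂φ

section ConvDens

variable {f g : ℝ → ℝ} {φ : Measure ℝ} [IsProbabilityMeasure φ]

theorem integrable_comp_sub (hf : Continuous f) {B : ℝ} (hB : ∀ x, |f x| ≤ B) (x : ℝ) :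
    Integrable (fun y => f (x - y)) φ :=
  Integrable.of_bound (by fun_prop) B (.of_forall fun y => hB (x - y))

theorem continuous_convDens (hf : Continuous f) {B : ℝ} (hB : ∀ x, |f x| ≤ B) :
    Continuous (convDens f φ) :=
  continuous_of_dominated (fun x => (integrable_comp_sub hf hB x).aestronglyMeasurable)
    (fun x => .of_forall fun y => hB (x - y)) (integrable_const B)
    (.of_forall fun y => by fun_prop)

theorem abs_convDens_le {B : ℝ} (hB : ∀ x, |f x| ≤ B) (x : ℝ) : |convDens f φ x| ≤ B := by
  have := norm_integral_le_of_norm_le_const (μ := φ) (f := fun y => f (x - y))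
    (.of_forall fun y => hB (x - y))
  simpa [convDens] using this

theorem convDens_add (hf : Continuous f) {B : ℝ} (hB : ∀ x, |f x| ≤ B) (hg : Continuous g)
    {B' : ℝ} (hB' : ∀ x, |g x| ≤ B') (x : ℝ) :
    convDens (fun x => f x + g x) φ x = convDens f φ x + convDens g φ x :=
  integral_add (integrable_comp_sub hf hB x) (integrable_comp_sub hg hB' x)

theorem integrable_prod_comp_sub (hf : Continuous f) (hi : Integrable f) :
    Integrable (fun z : ℝ × ℝ => f (z.1 - z.2)) (volume.prod φ) := by
  rw [integrable_prod_iff' (by fun_prop)]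
  refine ⟨.of_forall fun y => hi.comp_sub_right y, ?_⟩
  have : ∀ y, ∫ x, ‖f (x - y)‖ = ∫ x, ‖f x‖ := fun y =>
    integral_sub_right_eq_self (fun x => ‖f x‖) y
  simp_rw [this]
  exact integrable_const _

theorem integrable_convDens (hf : Continuous f) (hi : Integrable f) :
    Integrable (convDens f φ) :=
  (integrable_prod_comp_sub hf hi).integral_prod_left

theorem ft_convDens (hf : Continuous f) (hi : Integrable f) (t : ℝ) :
    ft (fun x => (convDens f φ x : ℂ)) t = ft (fun x => (f x : ℂ)) t * fourierLaw φ t := by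
  have hF : Integrable (Function.uncurry fun x y : ℝ =>
      (f (x - y) : ℂ) * Complex.exp (-(Complex.I * t * x))) (volume.prod φ) := by
    have h1 : Integrable (fun z : ℝ × ℝ => (f (z.1 - z.2) : ℂ)) (volume.prod φ) :=
      (integrable_prod_comp_sub hf hi).ofReal
    exact h1.mul_bdd (c := 1) (by fun_prop)
      (.of_forall fun z => (norm_exp_neg_I_mul t z.1).le)
  have h2 : ∀ x, (convDens f φ x : ℂ) * Complex.exp (-(Complex.I * t * x)) =
      ∫ y, (f (x - y) : ℂ) * Complex.exp (-(Complex.I * t * x)) ∂φ := fun x => by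
    rw [integral_mul_const, convDens, integral_complex_ofReal]
  rw [ft]
  simp_rw [h2]
  rw [integral_integral_swap hF, fourierLaw, ← integral_const_mul]
  refine integral_congr_ae (.of_forall fun y => ?_)
  simp only
  rw [ft, ← integral_mul_const, ← integral_sub_right_eq_self
    (fun x : ℝ => (f x : ℂ) * Complex.exp (-(Complex.I * t * x)) *
      Complex.exp (-(Complex.I * t * y))) y]
  refine integral_congr_ae (.of_forall fun x => ?_)
  simp only
  rw [mul_assoc (f (x - y) : ℂ), ← Complex.exp_add]
  congr 2
  push_cast
  ring

theorem obsLaw_eq (hf : Continuous f) {B : ℝ} (hB : ∀ x, |f x| ≤ B) (h0 : ∀ x, 0 ≤ f x) :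
    obsLaw f φ = volume.withDensity fun x => ENNReal.ofReal (convDens f φ x) := by
  have hm : Measurable fun x => ENNReal.ofReal (f x) := by fun_prop
  have hd : ∀ x, ENNReal.ofReal (convDens f φ x) = ∫⁻ y, ENNReal.ofReal (f (x - y)) ∂φ :=
    fun x => ofReal_integral_eq_lintegral_ofReal (integrable_comp_sub hf hB x)
      (.of_forall fun y => h0 (x - y))
  have : SFinite (volume.withDensity fun x => ENNReal.ofReal (f x)) := inferInstance
  refine Measure.ext_of_lintegral _ fun u hu => ?_
  rw [obsLaw, Measure.lintegral_conv hu,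
    lintegral_withDensity_eq_lintegral_mul _ hm
      (Measurable.lintegral_prod_right' (f := fun z : ℝ × ℝ => u (z.1 + z.2)) (by fun_prop)),
    lintegral_withDensity_eq_lintegral_mul _
      ((continuous_convDens hf hB).measurable.ennreal_ofReal) hu]
  simp only [Pi.mul_apply, hd]
  have h1 : ∀ x, ENNReal.ofReal (f x) * ∫⁻ y, u (x + y) ∂φ =
      ∫⁻ y, ENNReal.ofReal (f x) * u (x + y) ∂φ := fun x =>
    (lintegral_const_mul _ (by fun_prop)).symm
  have h2 : ∀ x, (∫⁻ y, ENNReal.ofReal (f (x - y)) ∂φ) * u x =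
      ∫⁻ y, ENNReal.ofReal (f (x - y)) * u x ∂φ := fun x =>
    (lintegral_mul_const _ (by fun_prop)).symm
  simp_rw [h1, h2]
  refine (lintegral_lintegral_swap
    (Measurable.aemeasurable (by unfold Function.uncurry; fun_prop))).trans (Eq.trans ?_
      (lintegral_lintegral_swap
        (Measurable.aemeasurable (by unfold Function.uncurry; fun_prop))).symm)
  refine lintegral_congr fun y => ?_
  rw [← lintegral_sub_right_eq_self (fun x => ENNReal.ofReal (f x) * u (x + y)) y]
  simp

theorem isProbabilityMeasure_obsLaw (hi : Integrable f) (h0 : ∀ x, 0 ≤ f x)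
    (h1 : ∫ x, f x = 1) : IsProbabilityMeasure (obsLaw f φ) := by
  have : IsProbabilityMeasure (volume.withDensity fun x => ENNReal.ofReal (f x)) := by
    refine ⟨?_⟩
    rw [withDensity_apply _ MeasurableSet.univ, setLIntegral_univ,
      ← ofReal_integral_eq_lintegral_ofReal hi (.of_forall h0), h1, ENNReal.ofReal_one]
  unfold obsLaw
  infer_instance

/-- Errors `|y| ≤ M` carry mass at least `1/2`, and for them `1 + (x - y)² ≤ 2(1 + x²)(1 + M²)`.
This is the only way in which the constants depend on the location of `φ`. -/
theorem le_convDens (hf : Continuous f) {B : ℝ} (hB : ∀ x, |f x| ≤ B) {κ M : ℝ} (hκ : 0 ≤ κ)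
    (hlow : ∀ x, κ * (1 + x ^ 2)⁻¹ ≤ f x) (hM : 1 / 2 ≤ φ (Set.Icc (-M) M)) (x : ℝ) :
    κ / (4 * (1 + M ^ 2)) * (1 + x ^ 2)⁻¹ ≤ convDens f φ x := by
  have h0 : ∀ x, 0 ≤ f x := fun x => (by positivity : 0 ≤ κ * (1 + x ^ 2)⁻¹).trans (hlow x)
  have hM' : 1 / 2 ≤ φ.real (Set.Icc (-M) M) := by
    rw [Measure.real, ← ENNReal.toReal_ofReal (by norm_num : (0 : ℝ) ≤ 1 / 2)]
    refine ENNReal.toReal_mono (measure_ne_top _ _) (le_trans (le_of_eq ?_) hM)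
    rw [ENNReal.ofReal_div_of_pos two_pos]
    simp
  set q := κ / (2 * (1 + M ^ 2)) * (1 + x ^ 2)⁻¹ with hq
  have hq0 : 0 ≤ q := by positivity
  have hint := integrable_comp_sub (φ := φ) hf hB x
  calc κ / (4 * (1 + M ^ 2)) * (1 + x ^ 2)⁻¹ = (1 / 2) * q := by rw [hq]; field_simp; norm_num
    _ ≤ φ.real (Set.Icc (-M) M) * q := by gcongr
    _ = ∫ _y in Set.Icc (-M) M, q ∂φ := by rw [setIntegral_const, smul_eq_mul]
    _ ≤ ∫ y in Set.Icc (-M) M, f (x - y) ∂φ := by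
        refine setIntegral_mono_on (integrable_const q).integrableOn hint.integrableOn
          measurableSet_Icc fun y hy => ?_
        refine le_trans ?_ (hlow (x - y))
        have hy2 : y ^ 2 ≤ M ^ 2 := sq_le_sq' hy.1 hy.2
        rw [hq, div_mul_eq_mul_div, ← div_eq_mul_inv, div_div, ← div_eq_mul_inv]
        gcongr
        nlinarith [sq_nonneg (x + y), mul_nonneg (sq_nonneg x) (sq_nonneg M)]
    _ ≤ convDens f φ x := setIntegral_le_integral hint (.of_forall fun y => h0 _)

end ConvDens

/-! ### Second moment of the likelihood ratio. -/

/-- Here `Φ` is controlled only on the two bands `2r ≤ |t| ≤ 4r`, outside which `u` vanishes. Within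
one band the mean value inequality applies to `Φ`; if a point lies outside, the Lipschitz bound of
`u` alone suffices; points in opposite bands are compared through `0`, where `u` vanishes. -/
theorem norm_mul_le_and_lipschitz {u Φ : ℝ → ℂ} {r b S : ℝ} (hr : 0 < r) (hS : 0 ≤ S)
    (hu0 : ∀ t, |t| ≤ 2 * r ∨ 4 * r ≤ |t| → u t = 0) (hb : ∀ t, ‖u t‖ ≤ b)
    (hub : ∀ t t', ‖u t - u t'‖ ≤ 2 * b * |t - t'|)
    (hΦ : ∀ t, 2 * r ≤ |t| → |t| ≤ 4 * r →
      DifferentiableAt ℝ Φ t ∧ ‖Φ t‖ ≤ S ∧ ‖deriv Φ t‖ ≤ S) :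
    (∀ t, ‖u t * Φ t‖ ≤ 3 * b * S) ∧
      ∀ t t', ‖u t * Φ t - u t' * Φ t'‖ ≤ 3 * b * S * |t - t'| := by
  have hb0 : 0 ≤ b := (norm_nonneg _).trans (hb 0)
  set s : Set ℝ := {t | 2 * r ≤ |t| ∧ |t| ≤ 4 * r} with hs
  have hz : ∀ t, t ∉ s → u t = 0 := by
    intro t ht
    refine hu0 t ?_
    by_contra! h
    exact ht ⟨h.1.le, h.2.le⟩
  have hout : ∀ t t', t' ∉ s → ‖u t * Φ t - u t' * Φ t'‖ ≤ 2 * b * S * |t - t'| := by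
    intro t t' ht'
    by_cases ht : t ∈ s
    · rw [hz t' ht', zero_mul, sub_zero, norm_mul]
      have h1 := hub t t'
      rw [hz t' ht', sub_zero] at h1
      calc ‖u t‖ * ‖Φ t‖ ≤ 2 * b * |t - t'| * S :=
            mul_le_mul h1 (hΦ t ht.1 ht.2).2.1 (norm_nonneg _) (by positivity)
        _ = _ := by ring
    · rw [hz t ht, hz t' ht']
      simp only [zero_mul, sub_zero, norm_zero]
      positivity
  have hconv : ∀ I : Set ℝ, Convex ℝ I → I ⊆ s → ∀ t ∈ I, ∀ t' ∈ I,
      ‖u t * Φ t - u t' * Φ t'‖ ≤ 3 * b * S * |t - t'| := by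
    intro I hI hIs t ht t' ht'
    have h1 := hI.norm_image_sub_le_of_norm_deriv_le
      (fun x hx => (hΦ x (hIs hx).1 (hIs hx).2).1) (fun x hx => (hΦ x (hIs hx).1 (hIs hx).2).2.2)
      ht' ht
    rw [Real.norm_eq_abs] at h1
    rw [show u t * Φ t - u t' * Φ t' = u t * (Φ t - Φ t') + (u t - u t') * Φ t' by ring]
    refine (norm_add_le _ _).trans ?_
    rw [norm_mul, norm_mul]
    have h2 := mul_le_mul (hb t) h1 (norm_nonneg _) hb0
    have h3 := mul_le_mul (hub t t') (hΦ t' (hIs ht').1 (hIs ht').2).2.1 (norm_nonneg _)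
      (by positivity)
    linarith
  refine ⟨fun t => ?_, fun t t' => ?_⟩
  · by_cases ht : t ∈ s
    · rw [norm_mul]
      have := mul_le_mul (hb t) (hΦ t ht.1 ht.2).2.1 (norm_nonneg _) hb0
      nlinarith [mul_nonneg hb0 hS]
    · rw [hz t ht, zero_mul, norm_zero]
      positivity
  · have h23 : 2 * b * S * |t - t'| ≤ 3 * b * S * |t - t'| := by gcongr; norm_num
    by_cases ht : t ∈ s
    swap
    · rw [norm_sub_rev, abs_sub_comm]
      rw [abs_sub_comm] at h23
      exact (hout t' t ht).trans h23
    by_cases ht' : t' ∈ s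
    swap
    · exact (hout t t' ht').trans h23
    have h0 : (0 : ℝ) ∉ s := fun h => by
      have := h.1
      rw [abs_zero] at this
      linarith
    have hpos : Set.Icc (2 * r) (4 * r) ⊆ s := fun x hx => by
      rw [hs, Set.mem_ofPred_eq, abs_of_nonneg (by linarith [hx.1])]
      exact hx
    have hneg : Set.Icc (-(4 * r)) (-(2 * r)) ⊆ s := fun x hx => by
      rw [hs, Set.mem_ofPred_eq, abs_of_nonpos (by linarith [hx.2])]
      exact ⟨by linarith [hx.2], by linarith [hx.1]⟩
    have hopp : |t| + |t'| ≤ |t - t'| →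
        ‖u t * Φ t - u t' * Φ t'‖ ≤ 3 * b * S * |t - t'| := by
      intro h
      have h1 := hout t 0 h0
      have h2 := hout t' 0 h0
      rw [hz 0 h0, zero_mul, sub_zero, sub_zero] at h1 h2
      refine (norm_sub_le _ _).trans ((add_le_add h1 h2).trans (le_trans ?_ h23))
      rw [← mul_add]
      gcongr
    rcases le_or_gt 0 t with h1 | h1 <;> rcases le_or_gt 0 t' with h2 | h2
    · obtain ⟨ha, hb⟩ := ht
      obtain ⟨ha', hb'⟩ := ht'
      rw [abs_of_nonneg h1] at ha hb
      rw [abs_of_nonneg h2] at ha' hb'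
      exact hconv _ (convex_Icc _ _) hpos t ⟨ha, hb⟩ t' ⟨ha', hb'⟩
    · refine hopp ?_
      rw [abs_of_nonneg h1, abs_of_neg h2, abs_of_nonneg (by linarith)]
      linarith
    · refine hopp ?_
      rw [abs_of_nonneg h2, abs_of_neg h1, abs_of_nonpos (by linarith)]
      linarith
    · obtain ⟨ha, hb⟩ := ht
      obtain ⟨ha', hb'⟩ := ht'
      rw [abs_of_neg h1] at ha hb
      rw [abs_of_neg h2] at ha' hb'
      exact hconv _ (convex_Icc _ _) hneg t ⟨by linarith, by linarith⟩ t'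
        ⟨by linarith, by linarith⟩

/-- The second moment of the likelihood ratio `(p + h) / p` in terms of a weighted `L²` norm
of `h`. -/
theorem lintegral_likelihood_sq_le {p h : ℝ → ℝ} (hp : Continuous p) (hh : Continuous h)
    (hpi : Integrable p) (hhi : Integrable h) (hp1 : ∫ x, p x = 1) (hh0 : ∫ x, h x = 0)
    {κ V : ℝ} (hκ : 0 < κ) (hV : 0 ≤ V) (hlow : ∀ x, κ * (1 + x ^ 2)⁻¹ ≤ p x)
    (hw : ∫⁻ x, ENNReal.ofReal ((1 + x ^ 2) * h x ^ 2) ≤ ENNReal.ofReal V)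
    (hph : ∀ x, 0 ≤ p x + h x) :
    ∫⁻ x, ENNReal.ofReal ((p x + h x) / p x) ^ 2
        ∂(volume.withDensity fun x => ENNReal.ofReal (p x)) ≤ ENNReal.ofReal (1 + V / κ) := by
  have hp0 : ∀ x, 0 < p x := fun x =>
    (by positivity : 0 < κ * (1 + x ^ 2)⁻¹).trans_le (hlow x)
  have hne : ∀ x, p x ≠ 0 := fun x => (hp0 x).ne'
  have hD : ∀ x, h x ^ 2 / p x ≤ κ⁻¹ * ((1 + x ^ 2) * h x ^ 2) := by
    intro x
    rw [div_le_iff₀ (hp0 x)]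
    have h1 : 1 ≤ κ⁻¹ * (1 + x ^ 2) * p x := by
      have := mul_le_mul_of_nonneg_left (hlow x) (by positivity : 0 ≤ κ⁻¹ * (1 + x ^ 2))
      refine le_trans (le_of_eq ?_) this
      field_simp
    nlinarith [mul_le_mul_of_nonneg_right h1 (sq_nonneg (h x))]
  have hDc : Continuous fun x => h x ^ 2 / p x := (hh.pow 2).div hp hne
  have hDl : ∫⁻ x, ENNReal.ofReal (h x ^ 2 / p x) ≤ ENNReal.ofReal (V / κ) := by
    calc ∫⁻ x, ENNReal.ofReal (h x ^ 2 / p x)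
        ≤ ∫⁻ x, ENNReal.ofReal κ⁻¹ * ENNReal.ofReal ((1 + x ^ 2) * h x ^ 2) :=
          lintegral_mono fun x => by
            rw [← ENNReal.ofReal_mul (by positivity)]
            exact ENNReal.ofReal_le_ofReal (hD x)
      _ ≤ ENNReal.ofReal κ⁻¹ * ENNReal.ofReal V := by
          rw [lintegral_const_mul' _ _ ENNReal.ofReal_ne_top]
          gcongr
      _ = _ := by rw [← ENNReal.ofReal_mul (by positivity), div_eq_inv_mul]
  have hD0 : ∀ x, 0 ≤ h x ^ 2 / p x := fun x => div_nonneg (sq_nonneg _) (hp0 x).le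
  have hDi : Integrable fun x => h x ^ 2 / p x := by
    refine ⟨hDc.aestronglyMeasurable, ?_⟩
    rw [hasFiniteIntegral_iff_ofReal (.of_forall hD0)]
    exact hDl.trans_lt ENNReal.ofReal_lt_top
  have hDr : ∫ x, h x ^ 2 / p x ≤ V / κ := by
    rw [← ofReal_integral_eq_lintegral_ofReal hDi (.of_forall hD0)] at hDl
    exact (ENNReal.ofReal_le_ofReal_iff (by positivity)).1 hDl
  have hm : Measurable fun x => ENNReal.ofReal ((p x + h x) / p x) ^ 2 :=
    (((hp.add hh).div hp hne).measurable.ennreal_ofReal).pow_const 2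
  rw [lintegral_withDensity_eq_lintegral_mul _ hp.measurable.ennreal_ofReal hm]
  -- Expanding `p (1 + h/p)²`: the cross term `2h` integrates to `0`.
  have h1 : ∀ x, ENNReal.ofReal (p x) * ENNReal.ofReal ((p x + h x) / p x) ^ 2 =
      ENNReal.ofReal (p x + 2 * h x + h x ^ 2 / p x) := by
    intro x
    rw [← ENNReal.ofReal_pow (div_nonneg (hph x) (hp0 x).le), ← ENNReal.ofReal_mul (hp0 x).le]
    congr 1
    have := hne x
    field_simp
    ring
  have h2 : ∀ x, 0 ≤ p x + 2 * h x + h x ^ 2 / p x := by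
    intro x
    have : p x + 2 * h x + h x ^ 2 / p x = (p x + h x) ^ 2 / p x := by
      have := hne x
      field_simp
      ring
    rw [this]
    exact div_nonneg (sq_nonneg _) (hp0 x).le
  simp only [Pi.mul_apply, h1]
  have hsum : Integrable fun x => p x + 2 * h x := hpi.add (hhi.const_mul 2)
  have hall : Integrable fun x => p x + 2 * h x + h x ^ 2 / p x := hsum.add hDi
  rw [← ofReal_integral_eq_lintegral_ofReal hall (.of_forall h2)]
  refine ENNReal.ofReal_le_ofReal ?_
  rw [integral_add hsum hDi, integral_add hpi (hhi.const_mul 2), integral_const_mul, hp1, hh0]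
  linarith

/-- Centres are `3/r` apart, that is, at least `3` apart in the variable of the profile, where it
has dropped from `1` to at most `1/2`. -/
theorem bump_sub_bump_ge {A r : ℝ} (hA : 0 ≤ A) (hr : 0 < r) {j k : ℕ} (hjk : j ≠ k) :
    A / 2 ≤ |bump A r (3 * j / r) (3 * j / r) - bump A r (3 * k / r) (3 * j / r)| := by
  have h1 : r * (3 * (j : ℝ) / r - 3 * k / r) = 3 * ((j : ℝ) - k) := by field_simp
  have h2 : (1 : ℝ) ≤ |(j : ℝ) - k| := by
    have : (1 : ℤ) ≤ |(j : ℤ) - k| := Int.one_le_abs (by omega)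
    exact_mod_cast this
  have h3 : |modFejer (3 * ((j : ℝ) - k))| ≤ 1 / 2 := by
    refine abs_modFejer_le_half ?_
    rw [abs_mul, abs_of_pos (by norm_num : (0 : ℝ) < 3)]
    linarith
  rw [bump, bump, sub_self, mul_zero, modFejer_zero, h1, ← mul_sub, abs_mul, abs_of_nonneg hA]
  have h4 : 1 / 2 ≤ |1 - modFejer (3 * ((j : ℝ) - k))| := by
    rw [le_abs]
    left
    linarith [(abs_le.1 h3).2]
  calc A / 2 = A * (1 / 2) := by ring
    _ ≤ _ := by gcongr

theorem lintegral_convDens_bump_le {A r a S : ℝ} (hA : 0 ≤ A) (hr : 1 ≤ r) (ha : |a| ≤ 1)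
    (hS : 0 ≤ S) (φ : Measure ℝ) [IsProbabilityMeasure φ]
    (hΦ : ∀ t, 2 * r ≤ |t| → |t| ≤ 4 * r → DifferentiableAt ℝ (fourierLaw φ) t ∧
      ‖fourierLaw φ t‖ ≤ S ∧ ‖deriv (fourierLaw φ) t‖ ≤ S) :
    ∫⁻ x, ENNReal.ofReal ((1 + x ^ 2) * convDens (bump A r a) φ x ^ 2) ≤
      ENNReal.ofReal (2304 * (A ^ 2 * S ^ 2 / r)) := by
  have hr0 : 0 < r := by linarith
  have hc := continuous_bump A r a
  have hle := abs_bump_le hA hr ha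
  have hi := integrable_of_le_inv_one_add_sq hc hle
  have hB : ∀ x, |bump A r a x| ≤ 15 * A := fun x =>
    (hle x).trans (mul_le_of_le_one_right (by positivity) (inv_le_one_of_one_le₀ (by nlinarith)))
  obtain ⟨h1, h2⟩ := norm_mul_le_and_lipschitz (u := ft fun x => (bump A r a x : ℂ))
    (Φ := fourierLaw φ) (b := 8 * A * r⁻¹) hr0 hS (fun t ht => ft_bump_eq_zero hr0 ht)
    (norm_ft_bump_le hA hr0)
    (fun t t' => (norm_ft_bump_sub_le hA hr ha t t').trans_eq (by ring)) hΦ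
  have hft := ft_convDens (φ := φ) hc hi
  have h := lintegral_one_add_sq_mul_norm_sq_le
    (u := fun x => (convDens (bump A r a) φ x : ℂ)) (B := 15 * A) (R := 4 * r)
    (S := 3 * (8 * A * r⁻¹) * S)
    (Complex.continuous_ofReal.comp (continuous_convDens hc hB))
    (integrable_convDens hc hi).ofReal
    (fun x => by rw [Complex.norm_real]; exact abs_convDens_le hB x)
    (by linarith) ?_ (fun t => by rw [hft]; exact h1 t) (fun t t' => by rw [hft, hft]; exact h2 t t')
  · simp only [Complex.norm_real, Real.norm_eq_abs, sq_abs] at h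
    -- `(3 · 8 A r⁻¹ S)² · 4r = 2304 A² S² / r`.
    refine h.trans_eq ?_
    congr 1
    field_simp
    ring
  · intro t ht
    rw [hft, ft_bump_eq_zero hr0 (.inr ?_), zero_mul]
    by_contra! hlt
    exact ht ⟨(abs_lt.1 hlt).1.le, (abs_lt.1 hlt).2.le⟩

/-! ### The lower bound at a fixed resolution. -/

/-- The minimax bound at resolution `r`, when the Fourier transform of the error law and its
derivative are at most `S` at frequencies of order `r`. -/
theorem exists_le_minimaxRisk {ν : ℝ → ℝ} (hν : IsMeyerAux ν) {s L : ℝ} (hs : 0 < s) (hL : 0 < L)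
    (M : ℝ) :
    ∃ γ₀ > 0, ∃ K > 0, ∀ γ, 0 < γ → γ ≤ γ₀ →
      ∀ (φ : Measure ℝ) [IsProbabilityMeasure φ], 1 / 2 ≤ φ (Set.Icc (-M) M) →
      ∀ (n N : ℕ) (r S : ℝ), 0 < N → 1 ≤ r → 3 * N ≤ r → 0 ≤ S →
      (∀ t, 2 * r ≤ |t| → |t| ≤ 4 * r → DifferentiableAt ℝ (fourierLaw φ) t ∧
        ‖fourierLaw φ t‖ ≤ S ∧ ‖deriv (fourierLaw φ) t‖ ≤ S) →
      (1 + K * ((γ * r ^ (-s)) ^ 2 * S ^ 2 / r)) ^ n ≤ (N : ℝ) / 4 →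
      ENNReal.ofReal (γ * r ^ (-s) / 8) ≤ minimaxRisk ν φ n s L := by
  -- `σ ≤ 1` keeps the spectrum of the base density below every wavelet; its scaling coefficients
  -- are at most `σ ≤ L/2`, leaving half of the radius to the bump.
  set σ := min 1 (L / 2) with hσ
  have hσ0 : 0 < σ := lt_min one_pos (by positivity)
  have hσ1 : σ ≤ 1 := min_le_left _ _
  have hσL : σ ≤ L / 2 := min_le_right _ _
  set κ₀ := σ / (4 * Real.pi) * (Real.pi ^ 2)⁻¹ with hκ₀
  have hκ₀0 : 0 < κ₀ := by positivity
  set κ := κ₀ / (4 * (1 + M ^ 2)) with hκ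
  have hκ0 : 0 < κ := by positivity
  -- The first bound on `γ` makes `|g m| ≤ f₀`, so the alternatives are nonnegative; the second
  -- makes the bump's share `32 A + 32 · 4^s γ` of the Besov norm at most `L/2`.
  refine ⟨min (κ₀ / 15) (L / (64 * (1 + 4 ^ s))), by positivity, 2304 / κ, by positivity, ?_⟩
  intro γ hγ hγ₀ φ _ hM n N r S hN hr hNr hS hΦ hE
  have hr0 : 0 < r := by linarith
  set A := γ * r ^ (-s) with hA
  have hA0 : 0 < A := by positivity
  have hrs : r ^ (-s) ≤ 1 := Real.rpow_le_one_of_one_le_of_nonpos hr (by linarith)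
  have hAγ : A ≤ γ := mul_le_of_le_one_right hγ.le hrs
  have hγ1 : 15 * γ ≤ κ₀ := by
    have := hγ₀.trans (min_le_left _ _)
    linarith
  have hγ2 : γ * (64 * (1 + 4 ^ s)) ≤ L := by
    have := hγ₀.trans (min_le_right _ _)
    rwa [le_div_iff₀ (by positivity)] at this
  set a : Fin N → ℝ := fun m => 3 * ((m : ℕ) : ℝ) / r with ha
  have ha1 : ∀ m, |a m| ≤ 1 := by
    intro m
    simp only [ha]
    rw [abs_of_nonneg (by positivity), div_le_one hr0]
    have : ((m : ℕ) : ℝ) ≤ N := by exact_mod_cast m.2.le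
    linarith
  set g : Fin N → ℝ → ℝ := fun m => bump A r (a m) with hg
  set f₀ := baseDensity σ with hf₀
  have hf₀c : Continuous f₀ := continuous_baseDensity σ
  have hf₀i : Integrable f₀ := integrable_baseDensity hσ0
  have hf₀low : ∀ x, κ₀ * (1 + x ^ 2)⁻¹ ≤ f₀ x := le_baseDensity hσ0 hσ1
  have hf₀0 : ∀ x, 0 ≤ f₀ x := fun x =>
    (by positivity : 0 ≤ κ₀ * (1 + x ^ 2)⁻¹).trans (hf₀low x)
  have hf₀B : ∀ x, |f₀ x| ≤ σ := fun x => by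
    rw [abs_of_nonneg (hf₀0 x)]
    exact baseDensity_le hσ0 x
  have hgc : ∀ m, Continuous (g m) := fun m => continuous_bump _ _ _
  have hgle : ∀ m x, |g m x| ≤ 15 * A * (1 + x ^ 2)⁻¹ := fun m => abs_bump_le hA0.le hr (ha1 m)
  have hgi : ∀ m, Integrable (g m) := fun m => integrable_of_le_inv_one_add_sq (hgc m) (hgle m)
  have hgB : ∀ m x, |g m x| ≤ 15 * A := fun m x =>
    (hgle m x).trans (mul_le_of_le_one_right (by positivity) (inv_le_one_of_one_le₀ (by nlinarith)))
  have hgf : ∀ m x, |g m x| ≤ f₀ x := fun m x => by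
    refine (hgle m x).trans (le_trans ?_ (hf₀low x))
    gcongr
    linarith
  set f : Fin N → ℝ → ℝ := fun m x => f₀ x + g m x with hf
  have hfc : ∀ m, Continuous (f m) := fun m => hf₀c.add (hgc m)
  have hf0 : ∀ m x, 0 ≤ f m x := fun m x => by
    have := (abs_le.1 (hgf m x)).1
    simp only [hf]
    linarith
  have hfi : ∀ m, Integrable (f m) := fun m => hf₀i.add (hgi m)
  have hfB : ∀ m x, |f m x| ≤ σ + 15 * A := fun m x =>
    (abs_add_le _ _).trans (add_le_add (hf₀B x) (hgB m x))
  have hf1 : ∀ m, ∫ x, f m x = 1 := fun m => by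
    simp only [hf]
    rw [integral_add hf₀i (hgi m), integral_baseDensity hσ0, integral_bump hr0, add_zero]
  have hmem : ∀ m, f m ∈ densityBall ν s L := by
    intro m
    refine ⟨hfc m, memLp_top_of_bound (hfc m).aestronglyMeasurable _ (.of_forall (hfB m)), ?_,
      hf0 m, hfi m, hf1 m⟩
    refine (besovNorm_add_le hν hs hf₀i (hgi m) (B₁ := 1) (R₁ := σ) (B₂ := 8 * A * r⁻¹)
      (R₂ := 4 * r) hσ0.le (by linarith) (by positivity) (norm_ft_baseDensity_le hσ0)
      (fun t ht => ft_baseDensity_eq_zero hσ0 ht) (norm_ft_bump_le hA0.le hr0)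
      (fun t ht => ft_bump_eq_zero hr0 (.inr ht))).trans (ENNReal.ofReal_le_ofReal ?_)
    have h1 : 8 * A * r⁻¹ * (4 * r) = 32 * A := by field_simp; norm_num
    have h2 : (4 * r) ^ s * (32 * A) = 32 * 4 ^ s * γ := by
      rw [Real.mul_rpow (by norm_num) hr0.le, hA]
      have : r ^ s * r ^ (-s) = 1 := by rw [← Real.rpow_add hr0, add_neg_cancel, Real.rpow_zero]
      linear_combination 32 * 4 ^ s * γ * this
    rw [h1, h2]
    linarith
  set p := convDens f₀ φ with hp
  have hpc : Continuous p := continuous_convDens hf₀c hf₀B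
  have hplow : ∀ x, κ * (1 + x ^ 2)⁻¹ ≤ p x := le_convDens hf₀c hf₀B hκ₀0.le hf₀low hM
  have hp0 : ∀ x, 0 < p x := fun x =>
    (by positivity : 0 < κ * (1 + x ^ 2)⁻¹).trans_le (hplow x)
  have hconv : ∀ m x, convDens (f m) φ x = p x + convDens (g m) φ x := fun m =>
    convDens_add hf₀c hf₀B (hgc m) (hgB m)
  have hconv0 : ∀ m x, 0 ≤ p x + convDens (g m) φ x := fun m x => by
    rw [← hconv]
    exact integral_nonneg fun y => hf0 m _
  have hhc : ∀ m, Continuous (convDens (g m) φ) := fun m => continuous_convDens (hgc m) (hgB m)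
  have hQ : obsLaw f₀ φ = volume.withDensity fun x => ENNReal.ofReal (p x) :=
    obsLaw_eq hf₀c hf₀B hf₀0
  have hQp : IsProbabilityMeasure (obsLaw f₀ φ) :=
    isProbabilityMeasure_obsLaw hf₀i hf₀0 (integral_baseDensity hσ0)
  set ℓ : Fin N → ℝ → ℝ≥0∞ := fun m x => ENNReal.ofReal ((p x + convDens (g m) φ x) / p x) with hℓ
  have hℓm : ∀ m, Measurable (ℓ m) := fun m =>
    ((hpc.add (hhc m)).div hpc fun x => (hp0 x).ne').measurable.ennreal_ofReal
  have hmass : ∀ {u : ℝ → ℝ} {c : ℝ}, Continuous u → Integrable u →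
      ft (fun x => (u x : ℂ)) 0 = c → ∫ x, convDens u φ x = c := by
    intro u c hu hui h
    refine integral_eq_of_ft_zero ?_
    rw [ft_convDens hu hui, h]
    simp [fourierLaw]
  refine le_trans (le_of_eq ?_) (ofReal_le_minimaxRisk ν φ n s L hN f hmem a
    (δ := A / 4) (by positivity) ?_ (obsLaw f₀ φ) ℓ hℓm ?_
    (fun m => isProbabilityMeasure_obsLaw (hfi m) (hf0 m) (hf1 m)) ?_)
  · congr 1
    ring
  · intro m m' hmm
    have h := bump_sub_bump_ge hA0.le hr0 (Fin.val_injective.ne hmm)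
    simp only [hf, hg, ha]
    rw [add_sub_add_left_eq_sub]
    refine le_trans (le_of_eq ?_) h
    ring
  · intro m
    rw [hQ, obsLaw_eq (hfc m) (hfB m) (hf0 m),
      ← withDensity_mul _ hpc.measurable.ennreal_ofReal (hℓm m)]
    congr 1
    funext x
    rw [Pi.mul_apply, hℓ, ← ENNReal.ofReal_mul (hp0 x).le, mul_div_cancel₀ _ (hp0 x).ne', hconv]
  · intro m
    have hV := lintegral_convDens_bump_le hA0.le hr (ha1 m) hS φ hΦ
    have hp1 : ∫ x, p x = 1 := by
      refine hmass hf₀c hf₀i ?_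
      rw [ft_baseDensity hσ0]
      simp [tri_zero]
      norm_num
    have hh0 : ∫ x, convDens (g m) φ x = 0 := by
      refine hmass (hgc m) (hgi m) ?_
      rw [hg, ft_bump_eq_zero hr0 (.inl (by simpa using hr0.le)), Complex.ofReal_zero]
    have h := lintegral_likelihood_sq_le hpc (hhc m) (integrable_convDens hf₀c hf₀i)
      (integrable_convDens (hgc m) (hgi m)) hp1 hh0 hκ0 (by positivity) hplow hV (hconv0 m)
    rw [← hQ] at h
    refine (pow_le_pow_left₀ zero_le h n).trans ?_
    rw [← ENNReal.ofReal_pow (by positivity)]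
    refine ENNReal.ofReal_le_ofReal (le_trans (le_of_eq ?_) hE)
    congr 2
    ring

/-! ### Choice of the resolution in the two regimes. -/

theorem exists_pos_le_sq_mul_le {a X Y : ℝ} (ha : 0 < a) (hX : 0 < X) (hY : 0 < Y) :
    ∃ γ > 0, γ ≤ a ∧ γ ^ 2 * X ≤ Y := by
  refine ⟨min a (min 1 (Y / X)), by positivity, min_le_left _ _, ?_⟩
  set γ := min a (min 1 (Y / X))
  have h0 : 0 < γ := by positivity
  have h1 : γ ≤ 1 := (min_le_right _ _).trans (min_le_left _ _)
  have h2 : γ ≤ Y / X := (min_le_right _ _).trans (min_le_right _ _)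
  rw [le_div_iff₀ hX] at h2
  nlinarith [mul_le_mul_of_nonneg_right h1 (mul_nonneg h0.le hX.le)]

theorem one_add_pow_le_exp {x y : ℝ} (hx : 0 ≤ x) (n : ℕ) (h : n * x ≤ y) :
    (1 + x) ^ n ≤ Real.exp y := by
  calc (1 + x) ^ n ≤ Real.exp x ^ n :=
        pow_le_pow_left₀ (by positivity) (by linarith [Real.add_one_le_exp x]) n
    _ = Real.exp (n * x) := (Real.exp_nat_mul x n).symm
    _ ≤ _ := Real.exp_le_exp.2 h

/-- Half of the exponential decay will absorb the polynomial factor, whatever the signs of `w` and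
`w'`; the other half, once squared, still gives `e^{-c₀ r^α}`. -/
theorem exists_rpow_mul_exp_le_one (v : ℝ) {c α : ℝ} (hc : 0 < c) (hα : 0 < α) :
    ∃ T, ∀ x, T ≤ x → (1 + x ^ 2) ^ v * Real.exp (-c * x ^ α) ≤ 1 := by
  have h1 : Tendsto (fun x : ℝ => (2 : ℝ) ^ |v| *
      ((x ^ α) ^ (2 * |v| / α) * Real.exp (-c * x ^ α))) atTop (𝓝 (2 ^ |v| * 0)) :=
    ((tendsto_rpow_mul_exp_neg_mul_atTop_nhds_zero (2 * |v| / α) c hc).comp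
      (tendsto_rpow_atTop hα)).const_mul _
  rw [mul_zero] at h1
  obtain ⟨T, hT⟩ := eventually_atTop.1 (h1.eventually_le_const one_pos)
  refine ⟨max T 1, fun x hx => le_trans ?_ (hT x ((le_max_left _ _).trans hx))⟩
  have hx1 : 1 ≤ x := (le_max_right _ _).trans hx
  have hx0 : 0 < x := by linarith
  rw [← mul_assoc]
  gcongr
  calc (1 + x ^ 2) ^ v ≤ (1 + x ^ 2) ^ |v| :=
        Real.rpow_le_rpow_of_exponent_le (by nlinarith) (le_abs_self v)
    _ ≤ (2 * x ^ 2) ^ |v| := by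
        gcongr
        nlinarith
    _ = 2 ^ |v| * (x ^ α) ^ (2 * |v| / α) := by
        rw [Real.mul_rpow (by norm_num) (by positivity), ← Real.rpow_natCast, ← Real.rpow_mul hx0.le,
          ← Real.rpow_mul hx0.le]
        congr 2
        field_simp
        ring

theorem exists_rate_supersmooth {ν : ℝ → ℝ} (hν : IsMeyerAux ν)
    {s L C C' α : ℝ} (w w' : ℝ) {c₀ t₁ : ℝ} (M : ℝ) (hs : 0 < s) (hL : 0 < L) (hC : 0 < C)
    (hC' : 0 < C') (hα : 0 < α) (hc₀ : 0 < c₀) (ht₁ : 0 ≤ t₁) :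
    ∃ c : ℝ, 0 < c ∧ ∀ (φ : Measure ℝ) [IsProbabilityMeasure φ],
      FourierDecay φ C C' α w w' c₀ t₁ → 1 / 2 ≤ φ (Set.Icc (-M) M) → ∀ n : ℕ, 2 ≤ n →
        ENNReal.ofReal (c * (1 / Real.log n) ^ (s / α)) ≤ minimaxRisk ν φ n s L := by
  obtain ⟨γ₀, hγ₀, K, hK, hrisk⟩ := exists_le_minimaxRisk hν hs hL M
  obtain ⟨T, hT⟩ := exists_rpow_mul_exp_le_one (-w / 2) (half_pos hc₀) hα
  obtain ⟨T', hT'⟩ := exists_rpow_mul_exp_le_one (-w' / 2) (half_pos hc₀) hα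
  set D := max C C' with hD
  have hD0 : 0 < D := hC.trans_le (le_max_left _ _)
  obtain ⟨γ, hγ, hγγ₀, hγK⟩ := exists_pos_le_sq_mul_le hγ₀ (by positivity : 0 < K * D ^ 2) one_pos
  have hlog2 : 0 < Real.log 2 := Real.log_pos (by norm_num)
  -- The first term forces `r ≥ 48 + t₁ + |T| + |T'|` already at `n = 2`, the second `c₀ r^α ≥ log
  -- n`.
  set Λ := (48 + t₁ + |T| + |T'|) / Real.log 2 ^ (1 / α) + (1 / c₀) ^ (1 / α) with hΛ
  have hΛ0 : 0 < Λ := by positivity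
  have hΛα : 1 / c₀ ≤ Λ ^ α := by
    calc 1 / c₀ = ((1 / c₀) ^ (1 / α)) ^ α := by
          rw [← Real.rpow_mul (by positivity), one_div_mul_cancel hα.ne', Real.rpow_one]
      _ ≤ Λ ^ α := by
          gcongr
          rw [hΛ]
          exact le_add_of_nonneg_left (by positivity)
  refine ⟨γ * Λ ^ (-s) / 8, by positivity, fun φ _ hφ hM n hn => ?_⟩
  have hn' : (2 : ℝ) ≤ n := by exact_mod_cast hn
  have hlog : Real.log 2 ≤ Real.log n := Real.log_le_log two_pos hn'
  have hlogn : 0 < Real.log n := hlog2.trans_le hlog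
  set r := Λ * Real.log n ^ (1 / α) with hr
  have hr48 : 48 + t₁ + |T| + |T'| ≤ r := by
    calc 48 + t₁ + |T| + |T'| =
        (48 + t₁ + |T| + |T'|) / Real.log 2 ^ (1 / α) * Real.log 2 ^ (1 / α) := by
          field_simp
      _ ≤ r := by
          rw [hr]
          gcongr
          exact le_add_of_nonneg_right (by positivity)
  have hTr := le_abs_self T
  have hTr' := le_abs_self T'
  have hT0 := abs_nonneg T
  have hT0' := abs_nonneg T'
  have hr1 : 1 ≤ r := by linarith
  have hr0 : 0 < r := by linarith
  have hrα : Real.log n ≤ c₀ * r ^ α := by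
    rw [hr, Real.mul_rpow hΛ0.le (by positivity), ← Real.rpow_mul hlogn.le,
      one_div_mul_cancel hα.ne', Real.rpow_one, ← mul_assoc]
    refine le_mul_of_one_le_left hlogn.le ?_
    rwa [div_le_iff₀' hc₀] at hΛα
  set S := D * Real.exp (-(c₀ / 2) * r ^ α) with hS
  have hdecay : ∀ (B v U t : ℝ), B ≤ D → 0 ≤ B → U ≤ r →
      (∀ x, U ≤ x → (1 + x ^ 2) ^ v * Real.exp (-(c₀ / 2) * x ^ α) ≤ 1) → 2 * r ≤ |t| →
      B * (1 + t ^ 2) ^ v * Real.exp (-c₀ * |t| ^ α) ≤ S := by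
    intro B v U t hBD hB0 hU h ht
    have h1 := h |t| (by linarith)
    rw [sq_abs] at h1
    have h2 : Real.exp (-(c₀ / 2) * |t| ^ α) ≤ Real.exp (-(c₀ / 2) * r ^ α) := by
      refine Real.exp_le_exp.2 ?_
      have : r ^ α ≤ |t| ^ α := by
        gcongr
        linarith
      nlinarith
    rw [show -c₀ * |t| ^ α = -(c₀ / 2) * |t| ^ α + -(c₀ / 2) * |t| ^ α by ring, Real.exp_add]
    calc B * (1 + t ^ 2) ^ v * (Real.exp (-(c₀ / 2) * |t| ^ α) * Real.exp (-(c₀ / 2) * |t| ^ α))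
        = B * ((1 + t ^ 2) ^ v * Real.exp (-(c₀ / 2) * |t| ^ α)) *
            Real.exp (-(c₀ / 2) * |t| ^ α) := by ring
      _ ≤ D * 1 * Real.exp (-(c₀ / 2) * r ^ α) := by gcongr
      _ = S := by rw [mul_one]
  have hnS : n * S ^ 2 ≤ D ^ 2 := by
    have h1 : S ^ 2 = D ^ 2 * Real.exp (-(c₀ * r ^ α)) := by
      rw [hS, mul_pow, ← Real.exp_nat_mul]
      congr 2
      push_cast
      ring
    have h2 : n * Real.exp (-(c₀ * r ^ α)) ≤ 1 := by
      rw [Real.exp_neg, ← div_eq_mul_inv, div_le_one (Real.exp_pos _),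
        ← Real.log_le_iff_le_exp (by positivity)]
      exact hrα
    rw [h1]
    nlinarith [sq_nonneg D]
  have hrs : r ^ (-s) ≤ 1 := Real.rpow_le_one_of_one_le_of_nonpos hr1 (by linarith)
  -- The left side of the testing condition is at most `e ≤ 4 = 16/4`; the spacing needs `3 · 16 =
  -- 48 ≤ r`.
  have hmain := hrisk γ hγ hγγ₀ φ hM n 16 r S (by norm_num) hr1 (by push_cast; linarith)
    (by positivity) ?_ ?_
  · refine le_trans (le_of_eq ?_) hmain
    congr 1
    rw [hr, Real.mul_rpow hΛ0.le (by positivity), ← Real.rpow_mul hlogn.le, one_div,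
      Real.inv_rpow hlogn.le, ← Real.rpow_neg hlogn.le]
    rw [show 1 / α * -s = -(s / α) by ring]
    ring
  · intro t ht _
    obtain ⟨h1, h2, h3⟩ := hφ t (by linarith)
    exact ⟨h1, h2.trans (hdecay C _ T t (le_max_left _ _) hC.le (by linarith) hT ht),
      h3.trans (hdecay C' _ T' t (le_max_right _ _) hC'.le (by linarith) hT' ht)⟩
  · refine (one_add_pow_le_exp (y := 1) (by positivity) n ?_).trans ?_
    · have h1 : (γ * r ^ (-s)) ^ 2 * S ^ 2 / r ≤ γ ^ 2 * S ^ 2 := by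
        refine (div_le_self (by positivity) hr1).trans ?_
        gcongr
        exact mul_le_of_le_one_right hγ.le hrs
      calc n * (K * ((γ * r ^ (-s)) ^ 2 * S ^ 2 / r)) ≤ n * (K * (γ ^ 2 * S ^ 2)) := by gcongr
        _ = γ ^ 2 * K * (n * S ^ 2) := by ring
        _ ≤ γ ^ 2 * K * D ^ 2 := by gcongr
        _ = γ ^ 2 * (K * D ^ 2) := by ring
        _ ≤ 1 := hγK
    · have := Real.exp_one_lt_d9
      norm_num
      linarith

theorem log_le_two_mul_sqrt {x : ℝ} (hx : 0 < x) : Real.log x ≤ 2 * x ^ (1 / 2 : ℝ) := by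
  have := Real.log_le_rpow_div hx.le (by norm_num : (0 : ℝ) < 1 / 2)
  linarith

theorem exists_rate_polynomial {ν : ℝ → ℝ} (hν : IsMeyerAux ν)
    {s L C C' w w' t₁ : ℝ} (α M : ℝ) (hs : 0 < s) (hL : 0 < L) (hC : 0 < C)
    (ht₁ : 0 ≤ t₁) (hw : 0 ≤ w) (hww : w ≤ w') :
    ∃ c : ℝ, 0 < c ∧ ∀ (φ : Measure ℝ) [IsProbabilityMeasure φ],
      FourierDecay φ C C' α w w' 0 t₁ → 1 / 2 ≤ φ (Set.Icc (-M) M) → ∀ n : ℕ, 2 ≤ n →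
        ENNReal.ofReal (c * (Real.log n / n) ^ (s / (2 * s + 2 * w + 1))) ≤
          minimaxRisk ν φ n s L := by
  obtain ⟨γ₀, hγ₀, K, hK, hrisk⟩ := exists_le_minimaxRisk hν hs hL M
  set ρ := 2 * s + 2 * w + 1 with hρ
  have hρ1 : 1 ≤ ρ := by linarith
  have hρ0 : 0 < ρ := by linarith
  set D := max C C' with hD
  have hD0 : 0 < D := hC.trans_le (le_max_left _ _)
  -- With this `γ` the testing condition reads `n^(1/(2ρ)) ≤ N/4`, while `N` grows like `(n / log
  -- n)^(1/ρ)`.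
  obtain ⟨γ, hγ, hγγ₀, hγK⟩ := exists_pos_le_sq_mul_le hγ₀ (by positivity : 0 < K * D ^ 2)
    (by positivity : 0 < 1 / (2 * ρ))
  set Λ := 48 + t₁ with hΛ
  have hΛ0 : 0 < Λ := by linarith
  refine ⟨γ * Λ ^ (-s) / 8, by positivity, fun φ _ hφ hM n hn => ?_⟩
  have hn' : (2 : ℝ) ≤ n := by exact_mod_cast hn
  have hn0 : (0 : ℝ) < n := by linarith
  have hlogn : 0 < Real.log n := Real.log_pos (by linarith)
  set q := (n : ℝ) / Real.log n with hq
  have hq0 : 0 < q := by positivity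
  have hq1 : 1 ≤ q := by
    rw [hq, one_le_div hlogn]
    linarith [Real.log_le_sub_one_of_pos hn0]
  -- The logarithm costs at most a square root, which the halved exponent `1/(2ρ)` allows for.
  have hqn : (n : ℝ) ^ (1 / 2 : ℝ) / 2 ≤ q := by
    rw [hq, div_le_div_iff₀ two_pos hlogn]
    have h1 := mul_le_mul_of_nonneg_left (log_le_two_mul_sqrt hn0)
      (by positivity : (0 : ℝ) ≤ (n : ℝ) ^ (1 / 2 : ℝ))
    have h2 : (n : ℝ) ^ (1 / 2 : ℝ) * (n : ℝ) ^ (1 / 2 : ℝ) = n := by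
      rw [← Real.rpow_add hn0]
      norm_num
    linarith
  set r := Λ * q ^ (1 / ρ) with hr
  have hqρ : 1 ≤ q ^ (1 / ρ) := Real.one_le_rpow hq1 (by positivity)
  have hrΛ : Λ ≤ r := le_mul_of_one_le_right hΛ0.le hqρ
  have hr1 : 1 ≤ r := by linarith
  have hr0 : 0 < r := by linarith
  set N := ⌊r / 3⌋₊ with hN
  have hN1 : (N : ℝ) ≤ r / 3 := Nat.floor_le (by positivity)
  have hN2 : r / 3 < N + 1 := Nat.lt_floor_add_one _
  have hN0 : 0 < N := by
    have : (0 : ℝ) < N := by linarith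
    exact_mod_cast this
  have hNn : (n : ℝ) ^ (1 / (2 * ρ)) ≤ (N : ℝ) / 4 := by
    have h1 : (n : ℝ) ^ (1 / (2 * ρ)) ≤ 2 * q ^ (1 / ρ) := by
      calc (n : ℝ) ^ (1 / (2 * ρ)) = (2 * ((n : ℝ) ^ (1 / 2 : ℝ) / 2)) ^ (1 / ρ) := by
            rw [mul_div_cancel₀ _ two_ne_zero, ← Real.rpow_mul hn0.le]
            congr 1
            field_simp
        _ ≤ (2 * q) ^ (1 / ρ) := by gcongr
        _ = 2 ^ (1 / ρ) * q ^ (1 / ρ) := Real.mul_rpow two_pos.le hq0.le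
        _ ≤ 2 ^ (1 : ℝ) * q ^ (1 / ρ) := by
            gcongr
            · norm_num
            · rwa [div_le_one hρ0]
        _ = 2 * q ^ (1 / ρ) := by rw [Real.rpow_one]
    have h2 : 48 * q ^ (1 / ρ) ≤ r := by
      rw [hr]
      gcongr
      linarith
    linarith
  set S := D * r ^ (-w) with hS
  have hdecay : ∀ (B v t : ℝ), B ≤ D → w ≤ v → 2 * r ≤ |t| →
      B * (1 + t ^ 2) ^ (-v / 2) * Real.exp (-0 * |t| ^ α) ≤ S := by
    intro B v t hBD hv ht
    rw [neg_zero, zero_mul, Real.exp_zero, mul_one, hS]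
    have h1 : (1 + t ^ 2) ^ (-v / 2) ≤ r ^ (-w) := by
      have h2 : r ^ 2 ≤ 1 + t ^ 2 := by
        rw [← sq_abs t]
        nlinarith
      calc (1 + t ^ 2) ^ (-v / 2) ≤ (r ^ 2) ^ (-v / 2) :=
            Real.rpow_le_rpow_of_nonpos (by positivity) h2 (by linarith)
        _ = r ^ (-v) := by
            rw [← Real.rpow_natCast, ← Real.rpow_mul hr0.le]
            congr 1
            push_cast
            ring
        _ ≤ r ^ (-w) := Real.rpow_le_rpow_of_exponent_le hr1 (by linarith)
    gcongr
  have hrρ : r ^ (-ρ) ≤ Real.log n / n := by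
    calc r ^ (-ρ) ≤ (q ^ (1 / ρ)) ^ (-ρ) := by
          refine Real.rpow_le_rpow_of_nonpos (by positivity) ?_ (by linarith)
          exact le_mul_of_one_le_left (by positivity) (by linarith)
      _ = q⁻¹ := by
          rw [← Real.rpow_mul hq0.le, mul_neg, one_div_mul_cancel hρ0.ne', Real.rpow_neg_one]
      _ = Real.log n / n := by rw [hq, inv_div]
  have hmain := hrisk γ hγ hγγ₀ φ hM n N r S hN0 hr1 (by linarith) (by positivity) ?_ ?_
  · refine le_trans (le_of_eq ?_) hmain
    congr 1
    rw [hr, Real.mul_rpow hΛ0.le (by positivity), ← Real.rpow_mul hq0.le,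
      show Real.log n / n = q⁻¹ by rw [hq, inv_div], Real.inv_rpow hq0.le,
      ← Real.rpow_neg hq0.le, show 1 / ρ * -s = -(s / ρ) by ring]
    ring
  · intro t ht _
    obtain ⟨h1, h2, h3⟩ := hφ t (by linarith)
    exact ⟨h1, h2.trans (hdecay C w t (le_max_left _ _) le_rfl ht),
      h3.trans (hdecay C' w' t (le_max_right _ _) hww ht)⟩
  · refine (one_add_pow_le_exp (y := Real.log n * (1 / (2 * ρ))) (by positivity) n ?_).trans ?_
    · have h1 : (γ * r ^ (-s)) ^ 2 * S ^ 2 / r = γ ^ 2 * D ^ 2 * r ^ (-ρ) := by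
        have h2 : r ^ (-ρ) = (r ^ (-s)) ^ 2 * (r ^ (-w)) ^ 2 * r⁻¹ := by
          rw [← Real.rpow_natCast, ← Real.rpow_natCast, ← Real.rpow_mul hr0.le,
            ← Real.rpow_mul hr0.le, ← Real.rpow_neg_one, ← Real.rpow_add hr0, ← Real.rpow_add hr0]
          congr 1
          push_cast
          linarith
        rw [h2, hS]
        ring
      rw [h1]
      calc n * (K * (γ ^ 2 * D ^ 2 * r ^ (-ρ)))
          ≤ n * (K * (γ ^ 2 * D ^ 2 * (Real.log n / n))) := by gcongr
        _ = Real.log n * (γ ^ 2 * (K * D ^ 2)) := by field_simp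
        _ ≤ Real.log n * (1 / (2 * ρ)) := by gcongr
    · rwa [← Real.rpow_def_of_pos hn0]

end Deconvolution

end

theorem theorem1 (ν : ℝ → ℝ) (hν : IsMeyerAux ν)
    (s L C C' α w w' c₀ t₁ M : ℝ) (hs : 0 < s) (hL : 0 < L) (hC : 0 < C) (hC' : 0 < C')
    (hα : 0 < α) (hc₀ : 0 ≤ c₀) (ht₁ : 0 ≤ t₁) :
    ∃ c : ℝ, 0 < c ∧
      ∀ (φ : Measure ℝ) [IsProbabilityMeasure φ],
        FourierDecay φ C C' α w w' c₀ t₁ →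
        1 / 2 ≤ φ (Set.Icc (-M) M) →
        ∀ n : ℕ, 2 ≤ n →
          (0 < c₀ →
            ENNReal.ofReal (c * (1 / Real.log n) ^ (s / α)) ≤ minimaxRisk ν φ n s L) ∧
          (c₀ = 0 → 0 ≤ w → w ≤ w' →
            ENNReal.ofReal (c * (Real.log n / n) ^ (s / (2 * s + 2 * w + 1))) ≤
              minimaxRisk ν φ n s L) := by
  rcases hc₀.eq_or_lt with rfl | hpos
  · by_cases hw : 0 ≤ w ∧ w ≤ w'
    · obtain ⟨c, hc, h⟩ :=
        Deconvolution.exists_rate_polynomial hν α M hs hL hC ht₁ hw.1 hw.2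
      exact ⟨c, hc, fun φ _ hφ hM n hn =>
        ⟨fun h0 => absurd h0 (lt_irrefl _), fun _ _ _ => h φ hφ hM n hn⟩⟩
    · exact ⟨1, one_pos, fun φ _ _ _ n _ =>
        ⟨fun h0 => absurd h0 (lt_irrefl _), fun _ h1 h2 => absurd ⟨h1, h2⟩ hw⟩⟩
  · obtain ⟨c, hc, h⟩ :=
      Deconvolution.exists_rate_supersmooth hν w w' M hs hL hC hC' hα hpos ht₁
    exact ⟨c, hc, fun φ _ hφ hM n hn =>
      ⟨fun _ => h φ hφ hM n hn, fun h0 => absurd h0 hpos.ne'⟩⟩
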